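/- Fix a finite alphabet $\Sigma$. A timed word is a finite sequence $(t_1\cdot a_1)\cdots(t_n\cdot a_n)$ of delays $t_i\in\mathbb{R}_{\ge 0}$ and letters $a_i\in\Sigma$; $\mathbb{T}\Sigma^*$ is the set of timed words, a (timed) language is a set $L\subseteq\mathbb{T}\Sigma^*$, and $u^{-1}L=\{w\mid uw\in L\}$. A one-clock timed automaton has finitely many states, an initial state, final states, and finitely many transitions $(q,q',a,\varphi,r)$ whose guard $\varphi$ is a conjunction of constraints $c<x$, $x=c$, $x<c$ ($c\in\mathbb{N}$) on the single clock $x$ and whose bit $r\in\{0,1\}$ says whether the clock is reset ($r=0$) or not ($r=1$). It is deterministic (a 1-DTA) if two distinct transitions with the same source and letter have disjoint guards, and complete if every timed word has exactly one run from the initial state with clock value $0$. $L$ is 1-DTA recognizable if it is the language of a 1-DTA. The (maximum) constant of an automaton is the largest constant in its guards ($0$ if there is none). For $y,z\ge 0$ write $y\equiv z$ if $\lfloor y\rfloor=\lfloor z\rfloor$ and ($\{y\}=0\Leftrightarrow\{z\}=0$), and $y\equiv^K z$ if $y\equiv z$ or both $y,z>K$ (for $K=\infty$, $\equiv^\infty$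 is $\equiv$). The classes of $\equiv^K$, $K\in\mathbb{N}$, are the $K$-regions. An acceptor is a complete 1-DTA, with maximum constant $K$, such that every guard denotes a $K$-region and each state $q$ is associated with a $K$-region that contains the clock value of every timed word reaching $q$. It is strict if every transition whose guard is an equality $x=n$ resets the clock. A reset function is a map $R:\mathbb{T}\Sigma^*\to\mathbb{R}_{\ge 0}$ with $R(\epsilon)=0$ and $R(u(t\cdot a))\in\{0,R(u)+t\}$. A timed word is half-integral if all its delays are of the form $m/2$, $m\in\mathbb{N}$; $\mathcal{HI}$ is the set of half-integral words. Let $\mathit{hi}(x)=x$ if $x\in\mathbb{N}$ and $\mathit{hi}(x)=\lfloor x\rfloor+\frac12$ otherwise. The normal form with respect to $R$ is given by $N^R(\epsilon)=\epsilon$ and $N^R(u(t\cdot a))=N^R(u)(t'\cdot a)$, where $t'=\frac n2$, $n\in\mathbb{N}$, is such that $R(u)+t\equiv \mathit{hi}(R(u))+t'$. A profile is a pair $(R,\approx)$ of a reset function and an equivalence relation on $\mathcal{HI}$. Let $K_{(R,\approx)}\in\mathbb{N}\cup\{\infty\}$ be the least $K\in\mathbb{N}$ such that, for all $u\in\mathcal{HI}$,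 $a\in\Sigma$, $n\in\mathbb{N}$, $R(u)+\frac n2>K$ implies $u(\frac n2\cdot a)\approx u(K+\frac12\cdot a)$, and $\infty$ if there is no such $K$. The profile * is $L$-preserving if $u\approx v$ implies ($u\in L\Leftrightarrow v\in L$) for $u,v\in\mathcal{HI}$, and $w\in L\Leftrightarrow N^R(w)\in L$ for every $w\in\mathbb{T}\Sigma^*$; * is monotonic if for $u,v\in\mathcal{HI}$, $u\approx v$ implies $R(u)\equiv^{K_{(R,\approx)}}R(v)$ and $u(\frac n2\cdot a)\approx v(\frac n2\cdot a)$ for all $n\in\mathbb{N}$, $a\in\Sigma$, and moreover $R(u)\equiv R(N^R(u))$ for every $u\in\mathbb{T}\Sigma^*$; * has finite index if $\approx$ has finitely many classes and $K_{(R,\approx)}<\infty$. The syntactic reset function $\mathbf{R}^L$ of $L$ is defined by $\mathbf{R}^L(\epsilon)=0$, and $\mathbf{R}^L(u(t\cdot a))=0$ if $(u(t\cdot a))^{-1}L$ is 1-DTA recognizable, $\mathbf{R}^L(u(t\cdot a))=\mathbf{R}^L(u)+t$ otherwise. For $u,v\in\mathcal{HI}$, $u\approx^L v$ means $\mathbf{R}^L(u)=\mathbf{R}^L(v)$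 and $u^{-1}L=v^{-1}L$. The pair $(\mathbf{R}^L,\approx^L)$ is the syntactic profile of $L$. The canonical acceptor $\mathcal{A}_{(\mathbf{R}^L,\approx^L)}$ has as states the classes $[u]$ of $\approx^L$, initial state $[\epsilon]$, final states $[u]$ for $u\in L\cap\mathcal{HI}$, and a transition $([u],[v],a,g,s)$ whenever for some $n\in\mathbb{N}$ we have $u(\frac n2\cdot a)\approx^L v$, $g$ is the constraint describing the $K$-region of $\mathbf{R}^L(u)+\frac n2$ with $K=K_{(\mathbf{R}^L,\approx^L)}$ (that is, $x=t$, or $\lfloor t\rfloor<x<\lceil t\rceil$, or $K<x$, where $t=\mathbf{R}^L(u)+\frac n2$), and $s=0$ if $\mathbf{R}^L(v)=0$, $s=1$ otherwise. **Theorem.** For every language $L\subseteq\mathbb{T}\Sigma^*$: (a) $L$ is 1-DTA recognizable if and only if its syntactic profile $(\mathbf{R}^L,\approx^L)$ is $L$-preserving, monotonic and has finite index. (b) If $L$ is 1-DTA recognizable, then $\mathcal{A}_{(\mathbf{R}^L,\approx^L)}$ is a strict acceptor with language $L$; and no strict acceptor for $L$ has fewer states, or a smaller constant, than $\mathcal{A}_{(\mathbf{R}^L,\approx^L)}$.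 -/

import Mathlib

open scoped NNReal

namespace OneClock

/-! ### Timed words and timed languages -/

/-- A timed word `(t₁·a₁)…(tₙ·aₙ)`: a finite sequence of pairs (delay, letter). -/
abbrev TimedWord (α : Type*) := List (ℝ≥0 × α)

/-- The residual language `u⁻¹L = {w | uw ∈ L}`. -/
def residual {α : Type*} (u : TimedWord α) (L : Set (TimedWord α)) : Set (TimedWord α) :=
  {w | u ++ w ∈ L}

/-! ### Clock constraints and one-clock timed automata -/

/-- Clock constraints `φ ::= c < x | x = c | x < c | φ ∧ φ` with `c ∈ ℕ`. -/
inductive ClockConstraint : Type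
  | gt (c : ℕ) : ClockConstraint
  | eq (c : ℕ) : ClockConstraint
  | lt (c : ℕ) : ClockConstraint
  | and (φ ψ : ClockConstraint) : ClockConstraint

/-- The set `⟦φ⟧` of clock values that satisfy `φ`. -/
def ClockConstraint.denote : ClockConstraint → Set ℝ≥0
  | .gt c => {x | (c : ℝ≥0) < x}
  | .eq c => {x | x = (c : ℝ≥0)}
  | .lt c => {x | x < (c : ℝ≥0)}
  | .and φ ψ => φ.denote ∩ ψ.denote

/-- The largest constant that appears in a clock constraint. -/
def ClockConstraint.maxConst : ClockConstraint → ℕ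
  | .gt c => c
  | .eq c => c
  | .lt c => c
  | .and φ ψ => max φ.maxConst ψ.maxConst

/-- A transition `(q, q', a, φ, r)`; `resets = true` stands for `r = 0` (the clock is reset), and
`resets = false` for `r = 1` (the clock is not reset). -/
structure Transition (α Q : Type*) where
  source : Q
  target : Q
  letter : α
  guard : ClockConstraint
  resets : Bool

/-- The data `(Q, q_I, T, F)` of a one-clock timed automaton over `α`. Finiteness of `Q` and `T` is
imposed in `IsDTA`. -/
structure TA (α Q : Type*) where
  init : Q
  trans : Set (Transition α Q)
  final : Set Q

namespace TA

variable {α Q : Type*}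

/-- `A.IsRun c w e c'`: the sequence `e` of transitions is a run of `A` on `w` from the
configuration `c` to the configuration `c'`. -/
inductive IsRun (A : TA α Q) :
    Q × ℝ≥0 → TimedWord α → List (Transition α Q) → Q × ℝ≥0 → Prop
  | nil (c : Q × ℝ≥0) : IsRun A c [] [] c
  | cons (θ : Transition α Q) (ν t : ℝ≥0) (w : TimedWord α) (e : List (Transition α Q))
      (c' : Q × ℝ≥0) (hθ : θ ∈ A.trans) (hguard : ν + t ∈ θ.guard.denote)
      (hrun : IsRun A (θ.target, if θ.resets = true then 0 else ν + t) w e c') :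
      IsRun A (θ.source, ν) ((t, θ.letter) :: w) (θ :: e) c'

/-- The language `𝓛(A)`: the words with an accepting run from the initial configuration. -/
def language (A : TA α Q) : Set (TimedWord α) :=
  {w | ∃ e q ν, A.IsRun (A.init, 0) w e (q, ν) ∧ q ∈ A.final}

/-- Two distinct transitions differ in their source, or in their letter, or have disjoint guards. -/
def Deterministic (A : TA α Q) : Prop :=
  ∀ θ ∈ A.trans, ∀ θ' ∈ A.trans, θ ≠ θ' →
    θ.source ≠ θ'.source ∨ θ.letter ≠ θ'.letter ∨ θ.guard.denote ∩ θ'.guard.denote = ∅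

/-- Every timed word has exactly one run from the initial configuration. -/
def Complete (A : TA α Q) : Prop :=
  ∀ w, ∃! e, ∃ c, A.IsRun (A.init, 0) w e c

/-- The largest constant that appears in the transitions of `A` (`0` if there is none). -/
noncomputable def maxConst (A : TA α Q) : ℕ :=
  sSup ((fun θ : Transition α Q => θ.guard.maxConst) '' A.trans)

/-- `A` is a one-clock deterministic timed automaton (1-DTA). -/
structure IsDTA (A : TA α Q) : Prop where
  finite_states : Finite Q
  finite_trans : A.trans.Finite
  deterministic : A.Deterministic

end TA

/-- `L` is 1-DTA recognizable. -/
def Recognizable {α : Type*} (L : Set (TimedWord α)) : Prop :=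
  ∃ (Q : Type) (A : TA α Q), A.IsDTA ∧ A.language = L

/-! ### Region equivalence -/

/-- The fractional part of a non-negative real. -/
noncomputable def frac (y : ℝ≥0) : ℝ≥0 := y - (⌊y⌋₊ : ℝ≥0)

/-- `y ≡ z`: same integral part, and the fractional parts are both zero or both nonzero. -/
def RegionEq (y z : ℝ≥0) : Prop := ⌊y⌋₊ = ⌊z⌋₊ ∧ (frac y = 0 ↔ frac z = 0)

/-- `y ≡^K z`: `y ≡ z`, or both lie strictly above `K`. For `K = ∞` this is `y ≡ z`. -/
def RegionEqK (K : ℕ∞) (y z : ℝ≥0) : Prop :=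
  RegionEq y z ∨ ∃ k : ℕ, K = (k : ℕ∞) ∧ (k : ℝ≥0) < y ∧ (k : ℝ≥0) < z

/-- A `K`-region: a class of `≡^K`. -/
def IsRegion (K : ℕ) (S : Set ℝ≥0) : Prop := ∃ y, S = {z | RegionEqK (K : ℕ∞) y z}

/-! ### Acceptors -/

namespace TA

variable {α Q : Type*}

/-- `A` is a `K`-acceptor, `K` being its maximum constant: a complete 1-DTA whose guards denote
`K`-regions and each of whose states `q` comes with a `K`-region that contains the clock value of
every timed word that reaches `q`. -/
structure IsAcceptor (A : TA α Q) : Prop where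
  isDTA : A.IsDTA
  complete : A.Complete
  guard_region : ∀ θ ∈ A.trans, IsRegion A.maxConst θ.guard.denote
  state_region : ∃ region : Q → Set ℝ≥0, (∀ q, IsRegion A.maxConst (region q)) ∧
    ∀ u e q y, A.IsRun (A.init, 0) u e (q, y) → y ∈ region q

/-- A strict acceptor: every transition with an equality guard `x = n` resets the clock. -/
structure IsStrictAcceptor (A : TA α Q) : Prop extends IsAcceptor A where
  strict : ∀ θ ∈ A.trans, ∀ n : ℕ, θ.guard.denote = {(n : ℝ≥0)} → θ.resets = true

end TA

/-! ### Half-integral values and words -/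

/-- The word `w` is half-integral: every delay is of the form `m / 2` with `m ∈ ℕ`. -/
def IsHalfIntegral {α : Type*} (w : TimedWord α) : Prop :=
  ∀ p ∈ w, ∃ m : ℕ, p.1 = (m : ℝ≥0) / 2

/-- The half-integral words. -/
abbrev HIWord (α : Type*) := {w : TimedWord α // IsHalfIntegral w}

/-- The empty word. -/
def HIWord.nil {α : Type*} : HIWord α := ⟨[], by intro p hp; simp at hp⟩

/-- The half-integral word `u (n/2 · a)`. -/
noncomputable def HIWord.snoc {α : Type*} (u : HIWord α) (n : ℕ) (a : α) : HIWord α :=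
  ⟨u.1 ++ [((n : ℝ≥0) / 2, a)], by
    intro p hp
    rcases List.mem_append.1 hp with h | h
    · exact u.2 p h
    · exact ⟨n, by rw [List.mem_singleton.1 h]⟩⟩

open Classical in
/-- `hi x` is `x` if the fractional part of `x` is zero and `⌊x⌋ + 1/2` otherwise. -/
noncomputable def hi (x : ℝ≥0) : ℝ≥0 :=
  if frac x = 0 then x else (⌊x⌋₊ : ℝ≥0) + 1 / 2

/-! ### Reset functions -/

/-- `R` is a reset function: `R(ε) = 0`, and `R(u(t·a))` is `0` or `R(u) + t`. -/
def IsResetFunction {α : Type*} (R : TimedWord α → ℝ≥0) : Prop :=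
  R [] = 0 ∧ ∀ u t a, R (u ++ [(t, a)]) = 0 ∨ R (u ++ [(t, a)]) = R u + t

open Classical in
/-- The clock value after reading a word when the remaining language is `L`, the current clock
value is `y`, and the clock is reset exactly when the residual is 1-DTA recognizable. -/
noncomputable def syntacticResetFrom {α : Type*} :
    Set (TimedWord α) → ℝ≥0 → TimedWord α → ℝ≥0
  | _, y, [] => y
  | L, y, (t, a) :: w =>
    syntacticResetFrom (residual [(t, a)] L)
      (if Recognizable (residual [(t, a)] L) then 0 else y + t) w

/-- The syntactic reset function `R^L`. -/
noncomputable def syntacticReset {α : Type*} (L : Set (TimedWord α)) (u : TimedWord α) : ℝ≥0 :=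
  syntacticResetFrom L 0 u

open Classical in
theorem syntacticResetFrom_snoc {α : Type*} (u : TimedWord α) (t : ℝ≥0) (a : α) :
    ∀ (L : Set (TimedWord α)) (y : ℝ≥0), syntacticResetFrom L y (u ++ [(t, a)]) =
      if Recognizable (residual (u ++ [(t, a)]) L) then 0 else syntacticResetFrom L y u + t := by
  induction u with
  | nil => intro L y; rfl
  | cons p u ih => intro L y; exact ih _ _

theorem syntacticReset_nil {α : Type*} (L : Set (TimedWord α)) : syntacticReset L [] = 0 := rfl

open Classical in
/-- The inductive definition of `R^L`, prefix by prefix. -/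
theorem syntacticReset_snoc {α : Type*} (L : Set (TimedWord α)) (u : TimedWord α) (t : ℝ≥0)
    (a : α) : syntacticReset L (u ++ [(t, a)]) =
      if Recognizable (residual (u ++ [(t, a)]) L) then 0 else syntacticReset L u + t :=
  syntacticResetFrom_snoc u t a L 0

theorem isResetFunction_syntacticReset {α : Type*} (L : Set (TimedWord α)) :
    IsResetFunction (syntacticReset L) := by
  refine ⟨syntacticReset_nil L, fun u t a => ?_⟩
  rw [syntacticReset_snoc]
  split_ifs
  · exact Or.inl rfl
  · exact Or.inr rfl

/-! ### Normal forms -/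

/-- The normal form of the last part of a word of which the prefix `u` has already been read. -/
noncomputable def normalFormFrom {α : Type*} (R : TimedWord α → ℝ≥0) :
    TimedWord α → TimedWord α → TimedWord α
  | _, [] => []
  | u, (t, a) :: w => (hi (R u + t) - hi (R u), a) :: normalFormFrom R (u ++ [(t, a)]) w

/-- The normal form `N^R(u)`: `N^R(ε) = ε` and `N^R(u(t·a)) = N^R(u)(t'·a)`, where `t'` is the
half-integral delay with `R(u) + t ≡ hi(R(u)) + t'`, that is, `t' = hi(R(u) + t) - hi(R(u))`. -/
noncomputable def normalForm {α : Type*} (R : TimedWord α → ℝ≥0) (u : TimedWord α) :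
    TimedWord α :=
  normalFormFrom R [] u

theorem normalForm_nil {α : Type*} (R : TimedWord α → ℝ≥0) : normalForm R [] = [] := rfl

theorem normalForm_snoc {α : Type*} (R : TimedWord α → ℝ≥0) (u : TimedWord α) (t : ℝ≥0) (a : α) :
    normalForm R (u ++ [(t, a)]) = normalForm R u ++ [(hi (R u + t) - hi (R u), a)] := by
  have key : ∀ (w v : TimedWord α), normalFormFrom R v (w ++ [(t, a)]) =
      normalFormFrom R v w ++ [(hi (R (v ++ w) + t) - hi (R (v ++ w)), a)] := by
    intro w
    induction w with
    | nil => intro v; simp [normalFormFrom]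
    | cons p w ih => intro v; simp [normalFormFrom, ih]
  simpa [normalForm] using key u []

/-- `hi x` is a half-integer. -/
theorem hi_eq_half (x : ℝ≥0) : ∃ n : ℕ, hi x = (n : ℝ≥0) / 2 := by
  unfold hi
  split_ifs with h
  · refine ⟨2 * ⌊x⌋₊, ?_⟩
    have h1 : x ≤ (⌊x⌋₊ : ℝ≥0) := tsub_eq_zero_iff_le.1 h
    have h2 : x = (⌊x⌋₊ : ℝ≥0) := le_antisymm h1 (Nat.floor_le (by positivity))
    push_cast
    rw [← h2]
    field_simp
  · refine ⟨2 * ⌊x⌋₊ + 1, ?_⟩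
    push_cast
    field_simp

theorem hi_mono {x y : ℝ≥0} (h : x ≤ y) : hi x ≤ hi y := by
  have hf : ⌊x⌋₊ ≤ ⌊y⌋₊ := Nat.floor_mono h
  have hf' : (⌊x⌋₊ : ℝ≥0) ≤ (⌊y⌋₊ : ℝ≥0) := by exact_mod_cast hf
  have hfy : (⌊y⌋₊ : ℝ≥0) ≤ y := Nat.floor_le (by positivity)
  unfold hi
  split_ifs with h1 h2 h2
  · exact h
  · have : x ≤ (⌊x⌋₊ : ℝ≥0) := tsub_eq_zero_iff_le.1 h1
    exact (this.trans hf').trans le_self_add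
  · have h3 : ¬ x ≤ (⌊x⌋₊ : ℝ≥0) := fun h => h1 (tsub_eq_zero_iff_le.2 h)
    have h4 : y ≤ (⌊y⌋₊ : ℝ≥0) := tsub_eq_zero_iff_le.1 h2
    have h5 : ⌊x⌋₊ < ⌊y⌋₊ := by
      have : (⌊x⌋₊ : ℝ≥0) < (⌊y⌋₊ : ℝ≥0) := (not_le.1 h3).trans_le (h.trans h4)
      exact_mod_cast this
    have h6 : ((⌊x⌋₊ + 1 : ℕ) : ℝ≥0) ≤ (⌊y⌋₊ : ℝ≥0) := by exact_mod_cast h5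
    refine le_trans ?_ (h6.trans hfy)
    push_cast
    gcongr
    rw [← NNReal.coe_le_coe]
    norm_num
  · gcongr

theorem regionEq_hi (x : ℝ≥0) : RegionEq x (hi x) := by
  unfold hi
  split_ifs with h
  · exact ⟨rfl, Iff.rfl⟩
  · have h2 : ⌊(⌊x⌋₊ : ℝ≥0) + 1 / 2⌋₊ = ⌊x⌋₊ := by
      rw [Nat.floor_eq_iff (by positivity)]
      refine ⟨le_self_add, ?_⟩
      rw [← NNReal.coe_lt_coe]
      push_cast
      norm_num
    refine ⟨h2.symm, iff_of_false h ?_⟩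
    unfold frac
    rw [h2, add_tsub_cancel_left]
    norm_num

/-- The delay `t'` used in the normal form is the one prescribed: `t' = n/2` for some `n ∈ ℕ`, and
`R(u) + t ≡ hi(R(u)) + t'`. -/
theorem normalForm_delay_spec (r t : ℝ≥0) :
    (∃ n : ℕ, hi (r + t) - hi r = (n : ℝ≥0) / 2) ∧
      RegionEq (r + t) (hi r + (hi (r + t) - hi r)) := by
  have hle : hi r ≤ hi (r + t) := hi_mono le_self_add
  refine ⟨?_, ?_⟩
  · obtain ⟨m, hm⟩ := hi_eq_half (r + t)
    obtain ⟨n, hn⟩ := hi_eq_half r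
    refine ⟨m - n, ?_⟩
    rw [hm, hn, Nat.cast_tsub, NNReal.sub_div]
  · rw [add_tsub_cancel_of_le hle]
    exact regionEq_hi _

/-! ### Profiles -/

/-- A profile `(R, ≈)`: a reset function and an equivalence relation on half-integral words. -/
structure Profile (α : Type*) where
  R : TimedWord α → ℝ≥0
  isReset : IsResetFunction R
  rel : Setoid (HIWord α)

namespace Profile

variable {α : Type*}

/-- The property `C(K)`: for all half-integral `u`, all letters `a` and all `n ∈ ℕ`, if
`R(u) + n/2 > K` then `u(n/2 · a) ≈ u(K + 1/2 · a)`; here `K + 1/2 = (2K + 1)/2`. -/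
def C (P : Profile α) (K : ℕ) : Prop :=
  ∀ (u : HIWord α) (a : α) (n : ℕ), (K : ℝ≥0) < P.R u.1 + (n : ℝ≥0) / 2 →
    P.rel (u.snoc n a) (u.snoc (2 * K + 1) a)

/-- The constant `K_(R,≈)`: the least `K` with `C(K)`, and `∞` if there is none. -/
noncomputable def constant (P : Profile α) : ℕ∞ := sInf ((fun K : ℕ => (K : ℕ∞)) '' {K | P.C K})

/-- `(R, ≈)` is `L`-preserving. -/
structure Preserving (P : Profile α) (L : Set (TimedWord α)) : Prop where
  mem_iff_of_rel : ∀ u v : HIWord α, P.rel u v → (u.1 ∈ L ↔ v.1 ∈ L)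
  mem_iff_normalForm : ∀ w : TimedWord α, w ∈ L ↔ normalForm P.R w ∈ L

/-- `(R, ≈)` has finite index: `≈` has finitely many classes and `K_(R,≈) < ∞`. -/
structure FiniteIndex (P : Profile α) : Prop where
  finite_quotient : Finite (Quotient P.rel)
  constant_lt_top : P.constant < ⊤

/-- `(R, ≈)` is monotonic. -/
structure Monotonic (P : Profile α) : Prop where
  regionEq : ∀ u v : HIWord α, P.rel u v → RegionEqK P.constant (P.R u.1) (P.R v.1)
  snoc : ∀ u v : HIWord α, P.rel u v → ∀ (n : ℕ) (a : α), P.rel (u.snoc n a) (v.snoc n a)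
  regionEq_normalForm : ∀ u : TimedWord α, RegionEq (P.R u) (P.R (normalForm P.R u))

end Profile

open Classical in
/-- The clock constraint `φ_K(t)` that denotes the `K`-region of `t`. -/
noncomputable def regionGuard (K : ℕ) (t : ℝ≥0) : ClockConstraint :=
  if t ≤ (K : ℝ≥0) then
    if frac t = 0 then .eq ⌊t⌋₊ else .and (.gt ⌊t⌋₊) (.lt ⌈t⌉₊)
  else .gt K

/-- The automaton `A_(R,≈)` of a profile, for the language `L`. Its states are the classes `[u]`.
There is a transition `([u], [v], a, φ_K(R(u) + n/2), s)` whenever `u(n/2 · a) ≈ v`; it resets the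
clock iff `R(v) = 0`. Here `K = K_(R,≈)`, which is finite in all cases of interest. -/
noncomputable def Profile.automaton {α : Type*} (P : Profile α) (L : Set (TimedWord α)) :
    TA α (Quotient P.rel) where
  init := Quotient.mk P.rel HIWord.nil
  trans := {θ | ∃ (u v : HIWord α) (n : ℕ),
    P.rel (u.snoc n θ.letter) v ∧
    θ.source = Quotient.mk P.rel u ∧
    θ.target = Quotient.mk P.rel v ∧
    θ.guard = regionGuard P.constant.toNat (P.R u.1 + (n : ℝ≥0) / 2) ∧
    (θ.resets = true ↔ P.R v.1 = 0)}
  final := {q | ∃ u : HIWord α, u.1 ∈ L ∧ q = Quotient.mk P.rel u}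

/-- The syntactic profile `(R^L, ≈^L)`: `u ≈^L v` iff `R^L(u) = R^L(v)` and `u⁻¹L = v⁻¹L`. -/
noncomputable def syntacticProfile {α : Type*} (L : Set (TimedWord α)) : Profile α where
  R := syntacticReset L
  isReset := isResetFunction_syntacticReset L
  rel :=
    { r := fun u v => syntacticReset L u.1 = syntacticReset L v.1 ∧ residual u.1 L = residual v.1 L
      iseqv :=
        { refl := fun _ => ⟨rfl, rfl⟩
          symm := fun h => ⟨h.1.symm, h.2.symm⟩
          trans := fun h h' => ⟨h.1.trans h'.1, h.2.trans h'.2⟩ } }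

/-- The states of the canonical acceptor: the classes of `≈^L`. -/
abbrev CanonicalState {α : Type*} (L : Set (TimedWord α)) := Quotient (syntacticProfile L).rel

/-- The canonical acceptor `A_(R^L,≈^L)`. -/
noncomputable def canonicalAcceptor {α : Type*} (L : Set (TimedWord α)) :
    TA α (CanonicalState L) :=
  (syntacticProfile L).automaton L

end OneClock

namespace OneClock

/-! ### Regions -/

/-! A 1-DTA is treated as a clock machine, whose moves depend on the clock only up to `K`-regions.
The language accepted from a configuration `(s, y)` is recognizable if `y` is an integer (remember
the offset until the first reset) or exceeds the bound (the exact value is then irrelevant). The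
decisive fact is `ClockMachine.lang_eq_of_recognizable`: a recognizable language accepted from `(s,
y)` is accepted from `(s, y')` for every `y'` in the region of `y`. A machine for it starts at clock
`0`, two-clock region equivalent pairs are time-abstract bisimilar, and the two-clock region of `(y,
0)` is fixed by the region of `y`.

Let `L` be recognizable. Two words whose delays match region by region keep residuals accepted from
one state at region equivalent values of `R^L` (`SimilarReset.snoc`): if one new residual is
recognizable, both coincide and a fresh machine at clock `0` takes over; otherwise the old machine
cannot have reset. Applied to a word and its normal form, this makes the profile preserving and
monotonic. The index is finite because `R^L` never exceeds the clock of a machine for `L`, and only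
finitely many half-integral clock values matter.

Conversely, on `w` the canonical acceptor reaches the class of the normal form of `w` with clock
`R^L(w)` (`canonicalAcceptor_exists_isRun`), so it accepts `L`. It is strict because an integral
clock value leaves a recognizable residual. For minimality, the clock of a strict acceptor equals
`R^L(u)` on half-integral `u` with non-recognizable residual (`clock_eq_reset`), so half-integral
words that reach one state are `≈^L`-equivalent; and the constant of any 1-DTA for `L` satisfies the
condition `C`. -/

theorem frac_eq_zero_iff {y : ℝ≥0} : frac y = 0 ↔ y ≤ (⌊y⌋₊ : ℝ≥0) := tsub_eq_zero_iff_le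

theorem frac_natCast (n : ℕ) : frac (n : ℝ≥0) = 0 := by simp [frac]

theorem eq_natFloor_of_frac {y : ℝ≥0} (h : frac y = 0) : y = (⌊y⌋₊ : ℝ≥0) :=
  le_antisymm (frac_eq_zero_iff.1 h) (Nat.floor_le (zero_le))

/-- Regions expressed by integer thresholds, the form that linear arithmetic can use. -/
theorem regionEq_iff {y z : ℝ≥0} :
    RegionEq y z ↔ ∀ k : ℕ, (y ≤ k ↔ z ≤ k) ∧ (y < k ↔ z < k) := by
  constructor
  · rintro ⟨hfl, hfr⟩ k
    have hlt : y < k ↔ z < k := by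
      rw [← Nat.floor_lt (zero_le), ← Nat.floor_lt (zero_le), hfl]
    refine ⟨?_, hlt⟩
    have key : ∀ x : ℝ≥0, x ≤ k ↔ x < k ∨ (frac x = 0 ∧ ⌊x⌋₊ = k) := by
      intro x
      constructor
      · intro h
        rcases h.lt_or_eq with h | h
        · exact Or.inl h
        · subst h
          exact Or.inr ⟨frac_natCast k, Nat.floor_natCast k⟩
      · rintro (h | ⟨h, rfl⟩)
        · exact h.le
        · exact frac_eq_zero_iff.1 h
    rw [key y, key z, hlt, hfr, hfl]
  · intro h
    have hfl : ⌊y⌋₊ = ⌊z⌋₊ := by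
      refine eq_of_forall_lt_iff fun k => ?_
      rw [← not_le, ← not_le, ← Nat.lt_succ_iff, ← Nat.lt_succ_iff, Nat.floor_lt (zero_le),
        Nat.floor_lt (zero_le), (h _).2]
    refine ⟨hfl, ?_⟩
    rw [frac_eq_zero_iff, frac_eq_zero_iff, ← hfl, (h _).1]

theorem RegionEq.refl (y : ℝ≥0) : RegionEq y y := ⟨rfl, Iff.rfl⟩

theorem RegionEq.symm {y z : ℝ≥0} (h : RegionEq y z) : RegionEq z y := ⟨h.1.symm, h.2.symm⟩

theorem RegionEq.trans {x y z : ℝ≥0} (h : RegionEq x y) (h' : RegionEq y z) : RegionEq x z :=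
  ⟨h.1.trans h'.1, h.2.trans h'.2⟩

theorem RegionEq.le_iff {y z : ℝ≥0} (h : RegionEq y z) (k : ℕ) : y ≤ k ↔ z ≤ k :=
  (regionEq_iff.1 h k).1

theorem RegionEq.lt_iff {y z : ℝ≥0} (h : RegionEq y z) (k : ℕ) : y < k ↔ z < k :=
  (regionEq_iff.1 h k).2

theorem RegionEq.gt_iff {y z : ℝ≥0} (h : RegionEq y z) (k : ℕ) : (k : ℝ≥0) < y ↔ (k : ℝ≥0) < z := by
  rw [← not_le, ← not_le, h.le_iff]

theorem RegionEq.eq_natCast {y : ℝ≥0} {n : ℕ} (h : RegionEq y n) : y = n :=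
  le_antisymm ((h.le_iff n).2 le_rfl) (not_lt.1 fun h' => lt_irrefl _ ((h.lt_iff n).1 h'))

theorem RegionEq.eq_zero_iff {y z : ℝ≥0} (h : RegionEq y z) : y = 0 ↔ z = 0 := by
  simpa using h.le_iff 0

/-- Each region contains exactly one half-integer, so on half-integral values region equivalence is
equality. -/
theorem RegionEq.eq_of_half {y z : ℝ≥0} {m n : ℕ} (h : RegionEq y z) (hy : y = (m : ℝ≥0) / 2)
    (hz : z = (n : ℝ≥0) / 2) : y = z := by
  have aux : ∀ m k : ℕ, ((m : ℝ≥0) / 2 ≤ k ↔ m ≤ 2 * k) := by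
    intro m k
    rw [div_le_iff₀ (by norm_num)]
    constructor <;> intro h
    · have : m ≤ k * 2 := by exact_mod_cast h
      omega
    · have : m ≤ k * 2 := by omega
      exact_mod_cast this
  have aux' : ∀ m k : ℕ, ((m : ℝ≥0) / 2 < k ↔ m < 2 * k) := by
    intro m k
    rw [div_lt_iff₀ (by norm_num)]
    constructor <;> intro h
    · have : m < k * 2 := by exact_mod_cast h
      omega
    · have : m < k * 2 := by omega
      exact_mod_cast this
  have hmn : m = n := by
    -- Here `m / 2` is division in `ℕ`: the thresholds are `⌊y⌋` and `⌊y⌋ + 1`.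
    have h1 := h.le_iff (m / 2)
    have h2 := h.lt_iff (m / 2 + 1)
    have h3 := h.lt_iff (m / 2)
    rw [hy, hz, aux, aux] at h1
    rw [hy, hz, aux', aux'] at h2 h3
    omega
  rw [hy, hz, hmn]

theorem regionEqK_iff {K : ℕ} {y z : ℝ≥0} :
    RegionEqK (K : ℕ∞) y z ↔ RegionEq y z ∨ ((K : ℝ≥0) < y ∧ (K : ℝ≥0) < z) := by
  unfold RegionEqK
  refine or_congr_right ⟨?_, fun h => ⟨K, rfl, h⟩⟩
  rintro ⟨k, hk, h⟩
  obtain rfl : K = k := by exact_mod_cast hk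
  exact h

theorem RegionEq.toK {K : ℕ} {y z : ℝ≥0} (h : RegionEq y z) : RegionEqK (K : ℕ∞) y z := Or.inl h

theorem RegionEqK.symm {K : ℕ} {y z : ℝ≥0} (h : RegionEqK (K : ℕ∞) y z) :
    RegionEqK (K : ℕ∞) z y := by
  rw [regionEqK_iff] at *
  exact h.imp RegionEq.symm And.symm

theorem RegionEqK.trans {K : ℕ} {x y z : ℝ≥0} (h : RegionEqK (K : ℕ∞) x y)
    (h' : RegionEqK (K : ℕ∞) y z) : RegionEqK (K : ℕ∞) x z := by
  rw [regionEqK_iff] at *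
  rcases h with h | h <;> rcases h' with h' | h'
  · exact Or.inl (h.trans h')
  · exact Or.inr ⟨(h.gt_iff K).2 h'.1, h'.2⟩
  · exact Or.inr ⟨h.1, (h'.gt_iff K).1 h.2⟩
  · exact Or.inr ⟨h.1, h'.2⟩

theorem RegionEq.add_natCast {y z : ℝ≥0} (h : RegionEq y z) (n : ℕ) :
    RegionEq (y + n) (z + n) := by
  rw [regionEq_iff]
  intro k
  rcases lt_or_ge k n with hk | hk
  · have hk' : (k : ℝ≥0) < n := by exact_mod_cast hk
    have : ∀ x : ℝ≥0, ¬ x + n ≤ k := fun x => not_le.2 (hk'.trans_le le_add_self)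
    exact ⟨iff_of_false (this y) (this z),
      iff_of_false (fun h => this y h.le) fun h => this z h.le⟩
  · obtain ⟨j, rfl⟩ := Nat.exists_eq_add_of_le' hk
    push_cast
    rw [add_le_add_iff_right, add_le_add_iff_right, add_lt_add_iff_right, add_lt_add_iff_right]
    exact regionEq_iff.1 h j

theorem RegionEqK.add_natCast {K : ℕ} {y z : ℝ≥0} (h : RegionEqK (K : ℕ∞) y z) (n : ℕ) :
    RegionEqK (K : ℕ∞) (y + n) (z + n) := by
  rw [regionEqK_iff] at *
  exact h.imp (fun h => h.add_natCast n) fun h =>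
    ⟨h.1.trans_le le_self_add, h.2.trans_le le_self_add⟩

theorem ClockConstraint.denote_congr {K : ℕ} {x y : ℝ≥0} (h : RegionEqK (K : ℕ∞) x y) :
    ∀ {φ : ClockConstraint}, φ.maxConst ≤ K → (x ∈ φ.denote ↔ y ∈ φ.denote) := by
  have big : ∀ {c : ℕ} {z : ℝ≥0}, c ≤ K → (K : ℝ≥0) < z → (c : ℝ≥0) < z := fun hc hz =>
    lt_of_le_of_lt (by exact_mod_cast hc) hz
  have hgt : ∀ c : ℕ, c ≤ K → ((c : ℝ≥0) < x ↔ (c : ℝ≥0) < y) := by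
    intro c hc
    rcases regionEqK_iff.1 h with h | h
    · exact h.gt_iff c
    · exact iff_of_true (big hc h.1) (big hc h.2)
  have hlt : ∀ c : ℕ, c ≤ K → (x < (c : ℝ≥0) ↔ y < (c : ℝ≥0)) := by
    intro c hc
    rcases regionEqK_iff.1 h with h | h
    · exact h.lt_iff c
    · exact iff_of_false (big hc h.1).not_gt (big hc h.2).not_gt
  intro φ
  induction φ with
  | gt c => exact hgt c
  | lt c => exact hlt c
  | eq c =>
    intro hc
    change x = (c : ℝ≥0) ↔ y = (c : ℝ≥0)
    have h1 := hgt c hc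
    have h2 := hlt c hc
    constructor
    · rintro rfl
      exact le_antisymm (not_lt.1 fun h' => lt_irrefl _ (h1.2 h'))
        (not_lt.1 fun h' => lt_irrefl _ (h2.2 h'))
    · rintro rfl
      exact le_antisymm (not_lt.1 fun h' => lt_irrefl _ (h1.1 h'))
        (not_lt.1 fun h' => lt_irrefl _ (h2.1 h'))
  | and φ ψ ih ih' =>
    intro hc
    exact and_congr (ih ((le_max_left _ _).trans hc)) (ih' ((le_max_right _ _).trans hc))

/-! ### Guards that describe regions -/

theorem natCeil_of_frac_ne_zero {t : ℝ≥0} (h : frac t ≠ 0) : ⌈t⌉₊ = ⌊t⌋₊ + 1 := by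
  have h1 : (⌊t⌋₊ : ℝ≥0) < t := not_le.1 fun h' => h (frac_eq_zero_iff.2 h')
  refine le_antisymm (Nat.ceil_le_floor_add_one t) ?_
  exact Nat.lt_ceil.2 h1

theorem mem_regionGuard {K : ℕ} {t x : ℝ≥0} :
    x ∈ (regionGuard K t).denote ↔ RegionEqK (K : ℕ∞) t x := by
  rw [regionEqK_iff]
  unfold regionGuard
  split_ifs with h1 h2
  · change x = (⌊t⌋₊ : ℝ≥0) ↔ _
    have ht := eq_natFloor_of_frac h2
    rw [← ht]
    constructor
    · rintro rfl
      exact Or.inl (RegionEq.refl _)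
    · rintro (h | h)
      · rw [ht] at h ⊢
        exact h.symm.eq_natCast
      · exact absurd h.1 h1.not_gt
  · change (⌊t⌋₊ : ℝ≥0) < x ∧ x < (⌈t⌉₊ : ℝ≥0) ↔ _
    rw [natCeil_of_frac_ne_zero h2]
    constructor
    · rintro ⟨ha, hb⟩
      have hfl : ⌊x⌋₊ = ⌊t⌋₊ := by
        rw [Nat.floor_eq_iff (zero_le)]
        exact ⟨ha.le, by simpa using hb⟩
      refine Or.inl ⟨hfl.symm, iff_of_false h2 ?_⟩
      rw [frac_eq_zero_iff, hfl]
      exact ha.not_ge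
    · rintro (h | h)
      · refine ⟨(h.gt_iff _).1 (not_le.1 fun h' => h2 (frac_eq_zero_iff.2 h')),
          (h.lt_iff _).1 ?_⟩
        push_cast
        exact Nat.lt_floor_add_one t
      · exact absurd h.1 h1.not_gt
  · change (K : ℝ≥0) < x ↔ _
    have h1 := not_le.1 h1
    exact ⟨fun h => Or.inr ⟨h1, h⟩, fun h => h.elim (fun h => (h.gt_iff K).1 h1) And.right⟩

theorem denote_regionGuard (K : ℕ) (t : ℝ≥0) :
    (regionGuard K t).denote = {x | RegionEqK (K : ℕ∞) t x} :=
  Set.ext fun _ => mem_regionGuard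

theorem regionGuard_congr {K : ℕ} {t x : ℝ≥0} (h : RegionEqK (K : ℕ∞) t x) :
    regionGuard K t = regionGuard K x := by
  rcases regionEqK_iff.1 h with h | h
  · unfold regionGuard
    rw [if_congr (h.le_iff K) rfl rfl]
    split_ifs with h1 h2 h3 h3
    · rw [h.1]
    · exact absurd (h.2.1 h2) h3
    · exact absurd (h.2.2 h3) h2
    · rw [natCeil_of_frac_ne_zero h2, natCeil_of_frac_ne_zero h3, h.1]
    · rfl
  · unfold regionGuard
    rw [if_neg h.1.not_ge, if_neg h.2.not_ge]

theorem maxConst_regionGuard_le (K : ℕ) (t : ℝ≥0) : (regionGuard K t).maxConst ≤ K := by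
  unfold regionGuard
  split_ifs with h1 h2
  · exact Nat.floor_le_of_le h1
  · exact max_le (Nat.floor_le_of_le h1) (Nat.ceil_le.2 h1)
  · exact le_rfl

theorem finite_range_regionGuard (K : ℕ) : (Set.range (regionGuard K)).Finite := by
  refine (((Set.finite_Iic K).image ClockConstraint.eq).union
    ((((Set.finite_Iic K).prod (Set.finite_Iic K)).image
      fun p : ℕ × ℕ => ClockConstraint.and (.gt p.1) (.lt p.2)).union
      (Set.finite_singleton (ClockConstraint.gt K)))).subset ?_
  rintro _ ⟨t, rfl⟩
  unfold regionGuard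
  split_ifs with h1 h2
  · exact Or.inl ⟨_, Nat.floor_le_of_le h1, rfl⟩
  · exact Or.inr (Or.inl ⟨(_, _), ⟨Nat.floor_le_of_le h1, Nat.ceil_le.2 h1⟩, rfl⟩)
  · exact Or.inr (Or.inr rfl)

theorem finite_transitions {α Q : Type*} [Finite α] [Finite Q] {G : Set ClockConstraint}
    (hG : G.Finite) : {θ : Transition α Q | θ.guard ∈ G}.Finite := by
  have := hG.to_subtype
  refine (Set.finite_range fun p : Q × Q × α × G × Bool =>
    (⟨p.1, p.2.1, p.2.2.1, p.2.2.2.1, p.2.2.2.2⟩ : Transition α Q)).subset ?_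
  intro θ hθ
  exact ⟨(θ.source, θ.target, θ.letter, ⟨θ.guard, hθ⟩, θ.resets), rfl⟩

/-! ### Runs of deterministic automata -/

namespace TA

variable {α Q : Type*} {A : TA α Q}

theorem IsRun.snoc {c d : Q × ℝ≥0} {w : TimedWord α} {e : List (Transition α Q)}
    (h : A.IsRun c w e d) {θ : Transition α Q} (hθ : θ ∈ A.trans) (hs : θ.source = d.1)
    {t : ℝ≥0} (hg : d.2 + t ∈ θ.guard.denote) :
    A.IsRun c (w ++ [(t, θ.letter)]) (e ++ [θ])
      (θ.target, if θ.resets = true then 0 else d.2 + t) := by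
  induction h with
  | nil c =>
    obtain ⟨q, y⟩ := c
    subst hs
    exact .cons _ _ _ _ _ _ hθ hg (.nil _)
  | cons θ' ν s w e c' hθ' hg' _ ih => exact .cons _ _ _ _ _ _ hθ' hg' (ih hs hg)

theorem Deterministic.eq_of_mem (hA : A.Deterministic) {θ θ' : Transition α Q}
    (hθ : θ ∈ A.trans) (hθ' : θ' ∈ A.trans) (hs : θ.source = θ'.source)
    (hl : θ.letter = θ'.letter) {x : ℝ≥0} (hx : x ∈ θ.guard.denote)
    (hx' : x ∈ θ'.guard.denote) : θ = θ' := by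
  by_contra hne
  rcases hA θ hθ θ' hθ' hne with h | h | h
  · exact h hs
  · exact h hl
  · exact Set.notMem_empty x (h ▸ ⟨hx, hx'⟩)

theorem IsRun.unique (hA : A.Deterministic) {c d d' : Q × ℝ≥0} {w : TimedWord α}
    {e e' : List (Transition α Q)} (h : A.IsRun c w e d) (h' : A.IsRun c w e' d') :
    e = e' ∧ d = d' := by
  induction h generalizing e' with
  | nil c =>
    cases h'
    exact ⟨rfl, rfl⟩
  | cons θ ν t w e c' hθ hg _ ih =>
    generalize hc : (θ.source, ν) = c at h'
    generalize hw : (t, θ.letter) :: w = w' at h'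
    cases h' with
    | nil => cases hw
    | cons θ' ν' t' w' e'' d' hθ' hg' hr' =>
      injection hc with hs hν
      injection hw with hp hw
      injection hp with ht hl
      subst hν ht hw
      obtain rfl := hA.eq_of_mem hθ hθ' hs hl hg hg'
      obtain ⟨rfl, rfl⟩ := ih hr'
      exact ⟨rfl, rfl⟩

/-- Runs grow at the front, configurations are known prefix by prefix; this bridges the two for the
region automaton and the canonical acceptor. -/
theorem exists_isRun_of_forall_snoc {c : TimedWord α → Q × ℝ≥0} (h0 : c [] = (A.init, 0))
    (hc : ∀ w t a, ∃ θ ∈ A.trans, θ.source = (c w).1 ∧ θ.letter = a ∧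
      (c w).2 + t ∈ θ.guard.denote ∧
      c (w ++ [(t, a)]) = (θ.target, if θ.resets = true then 0 else (c w).2 + t))
    (w : TimedWord α) : ∃ e, A.IsRun (A.init, 0) w e (c w) := by
  induction w using List.reverseRecOn with
  | nil => exact ⟨[], h0 ▸ .nil _⟩
  | append_singleton w p ih =>
    obtain ⟨t, a⟩ := p
    obtain ⟨e, he⟩ := ih
    obtain ⟨θ, hθ, hs, rfl, hg, hn⟩ := hc w t a
    exact ⟨_, hn ▸ he.snoc hθ hs hg⟩

theorem mem_language_iff (hA : A.Deterministic) {w : TimedWord α} {e : List (Transition α Q)}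
    {c : Q × ℝ≥0} (h : A.IsRun (A.init, 0) w e c) : w ∈ A.language ↔ c.1 ∈ A.final := by
  constructor
  · rintro ⟨e', q, ν, h', hq⟩
    rw [(h.unique hA h').2]
    exact hq
  · exact fun hq => ⟨e, c.1, c.2, h, hq⟩

theorem maxConst_le_of_mem (hA : A.trans.Finite) {θ : Transition α Q} (hθ : θ ∈ A.trans) :
    θ.guard.maxConst ≤ A.maxConst :=
  le_csSup (hA.image _).bddAbove ⟨θ, hθ, rfl⟩

end TA

/-! ### Deterministic clock machines -/

/-- A total deterministic one-clock device whose moves depend on the clock value only up to the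
region equivalence with constant `bound`. -/
structure ClockMachine (α S : Type*) where
  step : S → α → ℝ≥0 → S × Bool
  final : Set S
  bound : ℕ
  step_congr : ∀ s a x y, RegionEqK (bound : ℕ∞) x y → step s a x = step s a y

namespace ClockMachine

variable {α S : Type*} (M : ClockMachine α S)

/-- The configuration after one move. -/
def next (c : S × ℝ≥0) (p : ℝ≥0 × α) : S × ℝ≥0 :=
  ((M.step c.1 p.2 (c.2 + p.1)).1,
    if (M.step c.1 p.2 (c.2 + p.1)).2 = true then 0 else c.2 + p.1)

/-- The configuration after reading a word. -/
def run (c : S × ℝ≥0) (w : TimedWord α) : S × ℝ≥0 := w.foldl M.next c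

/-- The words accepted from a configuration. -/
def lang (c : S × ℝ≥0) : Set (TimedWord α) := {w | (M.run c w).1 ∈ M.final}

theorem mem_lang {c : S × ℝ≥0} {w : TimedWord α} :
    w ∈ M.lang c ↔ (M.run c w).1 ∈ M.final := Iff.rfl

@[simp] theorem run_cons (c : S × ℝ≥0) (p : ℝ≥0 × α) (w : TimedWord α) :
    M.run c (p :: w) = M.run (M.next c p) w := rfl

theorem run_append (c : S × ℝ≥0) (u w : TimedWord α) :
    M.run c (u ++ w) = M.run (M.run c u) w := List.foldl_append

theorem run_snoc (c : S × ℝ≥0) (u : TimedWord α) (p : ℝ≥0 × α) :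
    M.run c (u ++ [p]) = M.next (M.run c u) p := M.run_append c u [p]

theorem residual_lang (c : S × ℝ≥0) (u : TimedWord α) :
    residual u (M.lang c) = M.lang (M.run c u) := by
  ext w
  simp [residual, lang, run_append]

/-- Above the bound both clocks stay above it and make the same moves, until a reset makes them
equal. -/
theorem lang_eq_of_bound_lt (s : S) {y y' : ℝ≥0} (hy : (M.bound : ℝ≥0) < y)
    (hy' : (M.bound : ℝ≥0) < y') : M.lang (s, y) = M.lang (s, y') := by
  have key : ∀ (w : TimedWord α) (s : S) (y y' : ℝ≥0), (M.bound : ℝ≥0) < y →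
      (M.bound : ℝ≥0) < y' → (M.run (s, y) w).1 = (M.run (s, y') w).1 := by
    intro w
    induction w with
    | nil => intros; rfl
    | cons p w ih =>
      intro s y y' hy hy'
      have h1 := hy.trans_le (le_self_add (b := p.1))
      have h2 := hy'.trans_le (le_self_add (b := p.1))
      have hst := M.step_congr s p.2 _ _ (regionEqK_iff.2 (Or.inr ⟨h1, h2⟩))
      simp only [run_cons, next, hst]
      split_ifs
      · rfl
      · exact ih _ _ _ h1 h2
  ext w
  rw [mem_lang, mem_lang, key w s y y' hy hy']

/-- The machine that starts with the clock advanced by `n`, until the first reset. -/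
def shift (n : ℕ) : ClockMachine α (S × Bool) where
  step s a x :=
    if s.2 = true then (((M.step s.1 a x).1, true), (M.step s.1 a x).2)
    else (((M.step s.1 a (x + n)).1, (M.step s.1 a (x + n)).2), (M.step s.1 a (x + n)).2)
  final := {s | s.1 ∈ M.final}
  bound := M.bound
  -- Adding an integer preserves `K`-equivalence, so the bound need not grow.
  step_congr s a x y h := by
    rw [M.step_congr s.1 a x y h, M.step_congr s.1 a _ _ (h.add_natCast n)]

/-- The flag turns true at the first reset: before it the simulated clock is `y + n` (`key2`), after
it the clocks agree (`key1`). -/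
theorem lang_shift (n : ℕ) (s : S) : (M.shift n).lang ((s, false), 0) = M.lang (s, n) := by
  have key1 : ∀ (w : TimedWord α) (s : S) (y : ℝ≥0),
      ((M.shift n).run ((s, true), y) w).1.1 = (M.run (s, y) w).1 := by
    intro w
    induction w with
    | nil => intros; rfl
    | cons p w ih =>
      intro s y
      simp only [run_cons, next, shift, if_true]
      exact ih _ _
  have key2 : ∀ (w : TimedWord α) (s : S) (y : ℝ≥0),
      ((M.shift n).run ((s, false), y) w).1.1 = (M.run (s, y + n) w).1 := by
    intro w
    induction w with
    | nil => intros; rfl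
    | cons p w ih =>
      intro s y
      have hy : y + p.1 + n = y + n + p.1 := by ring
      have hst : (M.shift n).step (s, false) p.2 (y + p.1) =
          (((M.step s p.2 (y + n + p.1)).1, (M.step s p.2 (y + n + p.1)).2),
            (M.step s p.2 (y + n + p.1)).2) := by rw [← hy]; rfl
      simp only [run_cons, next, hst]
      cases h : (M.step s p.2 (y + n + p.1)).2
      · have := ih (M.step s p.2 (y + n + p.1)).1 (y + p.1)
        rwa [hy] at this
      · exact key1 _ _ _
  ext w
  change _ ∈ M.final ↔ _ ∈ M.final
  rw [key2 w s 0, zero_add]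

end ClockMachine

/-! ### The two-clock region equivalence -/

/-- The region equivalence for the values of two clocks. -/
def PairRegionEq (y z y' z' : ℝ≥0) : Prop :=
  RegionEq y y' ∧ RegionEq z z' ∧
    ∀ k : ℤ, ((y : ℝ) - z ≤ k ↔ (y' : ℝ) - z' ≤ k) ∧ ((y : ℝ) - z < k ↔ (y' : ℝ) - z' < k)

/-- Thresholds in `ℤ`, to fit clock differences, which may be negative. -/
theorem regionEq_iff_real {y z : ℝ≥0} : RegionEq y z ↔
    ∀ k : ℤ, ((y : ℝ) ≤ k ↔ (z : ℝ) ≤ k) ∧ ((y : ℝ) < k ↔ (z : ℝ) < k) := by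
  rw [regionEq_iff]
  constructor
  · intro h k
    rcases lt_or_ge k 0 with hk | hk
    · have hk' : (k : ℝ) < 0 := by exact_mod_cast hk
      have := y.coe_nonneg
      have := z.coe_nonneg
      exact ⟨iff_of_false (by linarith) (by linarith), iff_of_false (by linarith) (by linarith)⟩
    · lift k to ℕ using hk
      exact_mod_cast h k
  · intro h k
    exact_mod_cast h k

theorem PairRegionEq.symm {y z y' z' : ℝ≥0} (h : PairRegionEq y z y' z') :
    PairRegionEq y' z' y z :=
  ⟨h.1.symm, h.2.1.symm, fun k => ⟨(h.2.2 k).1.symm, (h.2.2 k).2.symm⟩⟩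

theorem PairRegionEq.swap {y z y' z' : ℝ≥0} (h : PairRegionEq y z y' z') :
    PairRegionEq z y z' y' := by
  refine ⟨h.2.1, h.1, fun k => ?_⟩
  have h1 := (h.2.2 (-k)).1
  have h2 := (h.2.2 (-k)).2
  push_cast at h1 h2
  constructor
  · constructor <;> intro h3 <;> by_contra h4
    · have := h2.2 (by linarith)
      linarith
    · have := h2.1 (by linarith)
      linarith
  · constructor <;> intro h3 <;> by_contra h4
    · have := h1.2 (by linarith)
      linarith
    · have := h1.1 (by linarith)
      linarith

theorem RegionEq.pair_zero {y y' : ℝ≥0} (h : RegionEq y y') : PairRegionEq y 0 y' 0 :=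
  ⟨h, RegionEq.refl 0, by simpa using regionEq_iff_real.1 h⟩

theorem PairRegionEq.zero_left {y z y' z' : ℝ≥0} (h : PairRegionEq y z y' z') :
    PairRegionEq 0 z 0 z' := h.2.1.pair_zero.swap

theorem PairRegionEq.zero_right {y z y' z' : ℝ≥0} (h : PairRegionEq y z y' z') :
    PairRegionEq y 0 y' 0 := h.1.pair_zero

/-- A common delay leaves the difference of the clocks unchanged. -/
theorem PairRegionEq.of_add {y z y' z' t t' : ℝ≥0} (h : PairRegionEq y z y' z')
    (hy : RegionEq (y + t) (y' + t')) (hz : RegionEq (z + t) (z' + t')) :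
    PairRegionEq (y + t) (z + t) (y' + t') (z' + t') :=
  ⟨hy, hz, by simpa using h.2.2⟩

/-- When a clock lands on the integer `k`, the matching delay is forced to be `k - y'`; the other
clock then compares with `j` as the difference of the clocks does with `j - k`. -/
theorem PairRegionEq.exists_delay_of_eq {y z y' z' t : ℝ≥0} (h : PairRegionEq y z y' z') {k : ℕ}
    (hk : y + t = k) : ∃ t', PairRegionEq (y + t) (z + t) (y' + t') (z' + t') := by
  have hle : y' ≤ k := (h.1.le_iff k).1 (hk ▸ le_self_add)
  have hy' : y' + (k - y') = k := add_tsub_cancel_of_le hle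
  refine ⟨k - y', h.of_add (by rw [hy', hk]; exact RegionEq.refl _) ?_⟩
  rw [regionEq_iff_real]
  intro j
  have hk' : (y : ℝ) + t = k := by exact_mod_cast hk
  have h1 := h.swap.2.2 (j - k)
  push_cast [NNReal.coe_sub hle] at h1 ⊢
  refine ⟨?_, ?_⟩
  · constructor <;> intro h2
    · have := h1.1.1 (by linarith)
      linarith
    · have := h1.1.2 (by linarith)
      linarith
  · constructor <;> intro h2
    · have := h1.2.1 (by linarith)
      linarith
    · have := h1.2.2 (by linarith)
      linarith

theorem regionEq_of_lt_of_lt {y z : ℝ≥0} {k : ℕ} (h1 : (k : ℝ≥0) < y) (h2 : y < k + 1)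
    (h3 : (k : ℝ≥0) < z) (h4 : z < k + 1) : RegionEq y z := by
  have key : ∀ {x : ℝ≥0}, (k : ℝ≥0) < x → x < k + 1 → ⌊x⌋₊ = k ∧ frac x ≠ 0 := by
    intro x ha hb
    have hf : ⌊x⌋₊ = k := (Nat.floor_eq_iff (zero_le)).2 ⟨ha.le, hb⟩
    refine ⟨hf, ?_⟩
    rw [Ne, frac_eq_zero_iff, hf]
    exact ha.not_ge
  obtain ⟨a, b⟩ := key h1 h2
  obtain ⟨c, d⟩ := key h3 h4
  exact ⟨a.trans c.symm, iff_of_false b d⟩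

theorem PairRegionEq.exists_delay {y z y' z' : ℝ≥0} (h : PairRegionEq y z y' z') (t : ℝ≥0) :
    ∃ t', PairRegionEq (y + t) (z + t) (y' + t') (z' + t') := by
  by_cases hy : frac (y + t) = 0
  · exact h.exists_delay_of_eq (eq_natFloor_of_frac hy)
  by_cases hz : frac (z + t) = 0
  · obtain ⟨t', ht'⟩ := h.swap.exists_delay_of_eq (eq_natFloor_of_frac hz)
    exact ⟨t', ht'.swap⟩
  -- Both clocks land in open unit intervals. A delay must put `y'` into `(k, k+1)` and `z'` into
  -- `(l, l+1)`; the bounds `y1`, `z1`, `d1`, `d2` say that the two ranges of delays have a common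
  -- nonnegative point.
  obtain ⟨k, hk⟩ : ∃ k, k = ⌊y + t⌋₊ := ⟨_, rfl⟩
  obtain ⟨l, hl⟩ : ∃ l, l = ⌊z + t⌋₊ := ⟨_, rfl⟩
  have hk1 : (k : ℝ≥0) < y + t := hk ▸ not_le.1 fun h' => hy (frac_eq_zero_iff.2 h')
  have hl1 : (l : ℝ≥0) < z + t := hl ▸ not_le.1 fun h' => hz (frac_eq_zero_iff.2 h')
  have hk2 : y + t < k + 1 := hk ▸ Nat.lt_floor_add_one _
  have hl2 : z + t < l + 1 := hl ▸ Nat.lt_floor_add_one _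
  have rk1 : (k : ℝ) < y + t := by exact_mod_cast hk1
  have rl1 : (l : ℝ) < z + t := by exact_mod_cast hl1
  have rk2 : (y : ℝ) + t < k + 1 := by exact_mod_cast hk2
  have rl2 : (z : ℝ) + t < l + 1 := by exact_mod_cast hl2
  have ht := t.coe_nonneg
  have y1 : (y' : ℝ) < k + 1 := by
    have := ((regionEq_iff_real.1 h.1 (k + 1)).2).1 (by push_cast; linarith)
    push_cast at this
    exact this
  have z1 : (z' : ℝ) < l + 1 := by
    have := ((regionEq_iff_real.1 h.2.1 (l + 1)).2).1 (by push_cast; linarith)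
    push_cast at this
    exact this
  have d1 : (y' : ℝ) - z' < k - l + 1 := by
    have := (h.2.2 (k - l + 1)).2.1 (by push_cast; linarith)
    push_cast at this
    exact this
  have d2 : (z' : ℝ) - y' < l - k + 1 := by
    have := (h.swap.2.2 (l - k + 1)).2.1 (by push_cast; linarith)
    push_cast at this
    exact this
  obtain ⟨s, hs1, hs2⟩ : ∃ s : ℝ, max 0 (max (k - y' : ℝ) (l - z')) < s ∧
      s < min (k + 1 - y' : ℝ) (l + 1 - z') := by
    refine exists_between ?_
    simp only [lt_min_iff, max_lt_iff]
    refine ⟨⟨?_, ?_, ?_⟩, ?_, ?_, ?_⟩ <;> linarith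
  simp only [lt_min_iff, max_lt_iff] at hs1 hs2
  lift s to ℝ≥0 using hs1.1.le
  refine ⟨s, h.of_add (regionEq_of_lt_of_lt hk1 hk2 ?_ ?_) (regionEq_of_lt_of_lt hl1 hl2 ?_ ?_)⟩ <;>
    rw [← NNReal.coe_lt_coe] <;> push_cast <;> linarith

namespace ClockMachine

variable {α S S' : Type*} (M : ClockMachine α S) (M' : ClockMachine α S')

theorem next_eq_of_regionEq {y y' t t' : ℝ≥0} (s : S) (a : α)
    (h : RegionEq (y + t) (y' + t')) :
    ∃ (r : S) (b : Bool), M.next (s, y) (t, a) = (r, if b = true then 0 else y + t) ∧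
      M.next (s, y') (t', a) = (r, if b = true then 0 else y' + t') := by
  refine ⟨(M.step s a (y + t)).1, (M.step s a (y + t)).2, rfl, ?_⟩
  simp only [next, M.step_congr s a _ _ h.toK]

/-- Two-clock region equivalent pairs of configurations are time-abstract bisimilar. -/
theorem exists_run_eq {y z y' z' : ℝ≥0} (h : PairRegionEq y z y' z') (s : S) (r : S')
    (w : TimedWord α) : ∃ w', (M.run (s, y') w').1 = (M.run (s, y) w).1 ∧
      (M'.run (r, z') w').1 = (M'.run (r, z) w).1 := by
  induction w generalizing y z y' z' s r with
  | nil => exact ⟨[], rfl, rfl⟩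
  | cons p w ih =>
    obtain ⟨t, a⟩ := p
    obtain ⟨t', ht'⟩ := h.exists_delay t
    obtain ⟨s₁, b, e1, e2⟩ := M.next_eq_of_regionEq s a ht'.1
    obtain ⟨r₁, b', e3, e4⟩ := M'.next_eq_of_regionEq r a ht'.2.1
    have hp : PairRegionEq (if b = true then 0 else y + t) (if b' = true then 0 else z + t)
        (if b = true then 0 else y' + t') (if b' = true then 0 else z' + t') := by
      cases b <;> cases b'
      · exact ht'
      · exact ht'.zero_right
      · exact ht'.zero_left
      · exact ht'.zero_left.zero_right
    obtain ⟨w', h1, h2⟩ := ih hp s₁ r₁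
    refine ⟨(t', a) :: w', ?_, ?_⟩
    · rw [run_cons, run_cons, e1, e2, h1]
    · rw [run_cons, run_cons, e3, e4, h2]

/-- A word that separates the languages at `(y', z')` has a bisimilar word that separates them at
`(y, z)`. -/
theorem lang_eq_of_pairRegionEq {y z y' z' : ℝ≥0} (h : PairRegionEq y z y' z') {s : S} {r : S'}
    (he : M.lang (s, y) = M'.lang (r, z)) : M.lang (s, y') = M'.lang (r, z') := by
  ext w
  obtain ⟨w', h1, h2⟩ := M.exists_run_eq M' h.symm s r w
  have := Set.ext_iff.1 he w'
  rwa [ClockMachine.mem_lang, ClockMachine.mem_lang, h1, h2] at this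

end ClockMachine

/-! ### Recognizability by clock machines -/

namespace TA

variable {α Q : Type*} (A : TA α Q)

open Classical in
/-- The outcome of an enabled transition, or of a move to the sink if there is none. -/
noncomputable def pick (E : Set (Transition α Q)) : Option Q × Bool :=
  if h : E.Nonempty then (some h.some.target, h.some.resets) else (none, true)

/-- The transitions enabled in the state `s` on the letter `a` at clock value `x`. -/
def enabled (s : Option Q) (a : α) (x : ℝ≥0) : Set (Transition α Q) :=
  {θ | θ ∈ A.trans ∧ s = some θ.source ∧ θ.letter = a ∧ x ∈ θ.guard.denote}

/-- The clock machine of a 1-DTA, completed by a sink. -/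
noncomputable def machine (hA : A.trans.Finite) : ClockMachine α (Option Q) where
  step s a x := pick (A.enabled s a x)
  final := some '' A.final
  bound := A.maxConst
  step_congr s a x y h := by
    congr 1
    ext θ
    refine and_congr_right fun hθ => and_congr_right fun _ => and_congr_right fun _ => ?_
    exact ClockConstraint.denote_congr h (maxConst_le_of_mem hA hθ)

variable {A}

theorem machine_next (hA : A.IsDTA) {θ : Transition α Q} (hθ : θ ∈ A.trans) {y t : ℝ≥0}
    (hg : y + t ∈ θ.guard.denote) :
    (A.machine hA.finite_trans).next (some θ.source, y) (t, θ.letter) =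
      (some θ.target, if θ.resets = true then 0 else y + t) := by
  have hne : (A.enabled (some θ.source) θ.letter (y + t)).Nonempty := ⟨θ, hθ, rfl, rfl, hg⟩
  -- Determinism makes the choice of an enabled transition immaterial.
  have hs : hne.some = θ := by
    obtain ⟨h1, h2, h3, h4⟩ := hne.some_mem
    exact hA.deterministic.eq_of_mem h1 hθ (Option.some.inj h2).symm h3 h4 hg
  simp only [ClockMachine.next, machine, pick, dif_pos hne, hs]

theorem IsRun.machine_run (hA : A.IsDTA) {c d : Q × ℝ≥0} {w : TimedWord α}
    {e : List (Transition α Q)} (h : A.IsRun c w e d) :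
    (A.machine hA.finite_trans).run (some c.1, c.2) w = (some d.1, d.2) := by
  induction h with
  | nil c => rfl
  | cons θ ν t w e c' hθ hg _ ih => rw [ClockMachine.run_cons, machine_next hA hθ hg, ih]

theorem machine_run_none (hA : A.IsDTA) (y : ℝ≥0) (w : TimedWord α) :
    ((A.machine hA.finite_trans).run (none, y) w).1 = none := by
  induction w generalizing y with
  | nil => rfl
  | cons p w ih =>
    have : ¬ (A.enabled none p.2 (y + p.1)).Nonempty := by
      rintro ⟨θ, _, h, _⟩
      cases h
    simp only [ClockMachine.run_cons, ClockMachine.next, machine, pick, dif_neg this]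
    exact ih _

theorem exists_isRun_of_machine_run (hA : A.IsDTA) {q q' : Q} {y : ℝ≥0} {w : TimedWord α}
    (h : ((A.machine hA.finite_trans).run (some q, y) w).1 = some q') :
    ∃ e y', A.IsRun (q, y) w e (q', y') := by
  induction w generalizing q y with
  | nil =>
    cases h
    exact ⟨[], y, .nil _⟩
  | cons p w ih =>
    obtain ⟨t, a⟩ := p
    by_cases hne : (A.enabled (some q) a (y + t)).Nonempty
    · obtain ⟨θ, hθ, hs, rfl, hg⟩ := hne
      cases hs
      rw [ClockMachine.run_cons, machine_next hA hθ hg] at h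
      obtain ⟨e, y', hr⟩ := ih h
      exact ⟨θ :: e, y', .cons _ _ _ _ _ _ hθ hg hr⟩
    · rw [ClockMachine.run_cons] at h
      simp only [ClockMachine.next, machine, pick, dif_neg hne] at h
      exact absurd ((machine_run_none hA _ w).symm.trans h) (by simp)

theorem lang_machine (hA : A.IsDTA) :
    (A.machine hA.finite_trans).lang (some A.init, 0) = A.language := by
  ext w
  constructor
  · rintro ⟨q, hq, h⟩
    obtain ⟨e, y, hr⟩ := exists_isRun_of_machine_run hA h.symm
    exact ⟨e, q, y, hr, hq⟩
  · rintro ⟨e, q, y, hr, hq⟩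
    exact ⟨q, hq, by rw [hr.machine_run hA]⟩

end TA

namespace ClockMachine

variable {α : Type*} {S Q : Type*} (M : ClockMachine α S)

/-- The region automaton of a clock machine, its states renamed along `e`. -/
noncomputable def automaton (e : S ≃ Q) (s : S) : TA α Q where
  init := e s
  trans := {θ | ∃ x, θ.guard = regionGuard M.bound x ∧
    M.step (e.symm θ.source) θ.letter x = (e.symm θ.target, θ.resets)}
  final := e '' M.final

theorem isDTA_automaton [Finite α] [Finite Q] (e : S ≃ Q) (s : S) :
    (M.automaton e s).IsDTA where
  finite_states := inferInstance
  finite_trans := (finite_transitions (finite_range_regionGuard M.bound)).subset <| by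
    rintro θ ⟨x, hx, _⟩
    exact ⟨x, hx.symm⟩
  deterministic := by
    rintro ⟨p, q, a, g, b⟩ ⟨x, rfl, hx⟩ ⟨p', q', a', g', b'⟩ ⟨x', rfl, hx'⟩ hne
    by_contra! hcon
    obtain ⟨h1, h2, z, hz, hz'⟩ := hcon
    obtain rfl : p = p' := h1
    obtain rfl : a = a' := h2
    -- Guards that overlap describe the same region, on which the machine has a single move.
    have hxx : RegionEqK (M.bound : ℕ∞) x x' :=
      (mem_regionGuard.1 hz).trans (mem_regionGuard.1 hz').symm
    have h := hx.symm.trans ((M.step_congr _ _ _ _ hxx).trans hx')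
    obtain ⟨h3, h4⟩ := Prod.ext_iff.1 h
    have h3 : q = q' := e.symm.injective h3
    have h4 : b = b' := h4
    exact hne (by rw [h3, h4, regionGuard_congr hxx])

theorem language_automaton [Finite α] [Finite Q] (e : S ≃ Q) (s : S) :
    (M.automaton e s).language = M.lang (s, 0) := by
  have hrun := (M.automaton e s).exists_isRun_of_forall_snoc
    (c := fun w => (e (M.run (s, 0) w).1, (M.run (s, 0) w).2)) rfl (by
      intro w t a
      refine ⟨⟨e (M.run (s, 0) w).1,
        e (M.step (M.run (s, 0) w).1 a ((M.run (s, 0) w).2 + t)).1, a,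
        regionGuard M.bound ((M.run (s, 0) w).2 + t),
        (M.step (M.run (s, 0) w).1 a ((M.run (s, 0) w).2 + t)).2⟩, ⟨_, rfl, ?_⟩, rfl, rfl,
        mem_regionGuard.2 (RegionEq.refl _).toK, ?_⟩
      · simp
      · simp [run_snoc, next])
  ext w
  obtain ⟨r, hr⟩ := hrun w
  rw [TA.mem_language_iff (M.isDTA_automaton e s).deterministic hr]
  exact e.injective.mem_set_image

theorem recognizable_lang_zero [Finite α] [Finite S] (s : S) : Recognizable (M.lang (s, 0)) :=
  ⟨_, M.automaton (Finite.equivFin S) s, M.isDTA_automaton _ s, M.language_automaton _ s⟩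

theorem recognizable_lang_natCast [Finite α] [Finite S] (s : S) (n : ℕ) :
    Recognizable (M.lang (s, n)) :=
  M.lang_shift n s ▸ (M.shift n).recognizable_lang_zero (s, false)

/-- Beyond the bound the clock may be replaced by the integer `bound + 1`. -/
theorem recognizable_lang_of_bound_lt [Finite α] [Finite S] (s : S) {y : ℝ≥0}
    (hy : (M.bound : ℝ≥0) < y) : Recognizable (M.lang (s, y)) := by
  rw [M.lang_eq_of_bound_lt s hy (y' := (M.bound + 1 : ℕ)) (by exact_mod_cast Nat.lt_succ_self _)]
  exact M.recognizable_lang_natCast s _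

end ClockMachine

theorem Recognizable.exists_machine {α : Type*} {L : Set (TimedWord α)} (h : Recognizable L) :
    ∃ (S : Type) (_ : Finite S) (M : ClockMachine α S) (s : S), L = M.lang (s, 0) := by
  obtain ⟨Q, A, hA, rfl⟩ := h
  have := hA.finite_states
  exact ⟨Option Q, inferInstance, A.machine hA.finite_trans, some A.init,
    (TA.lang_machine hA).symm⟩

/-- A recognizable language accepted from a configuration does not depend on the precise clock
value in its region. -/
theorem ClockMachine.lang_eq_of_recognizable {α S : Type*} (M : ClockMachine α S) {s : S}
    {y y' : ℝ≥0} (h : Recognizable (M.lang (s, y))) (hy : RegionEq y y') :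
    M.lang (s, y') = M.lang (s, y) := by
  obtain ⟨S', _, M', r, hr⟩ := h.exists_machine
  rw [hr]
  exact M.lang_eq_of_pairRegionEq M' hy.pair_zero hr

end OneClock

namespace OneClock

/-! ### Half-integral words -/

section HalfIntegral

variable {α : Type*}

theorem HIWord.induction {p : HIWord α → Prop} (nil : p HIWord.nil)
    (snoc : ∀ (u : HIWord α) (n : ℕ) (a : α), p u → p (u.snoc n a)) (u : HIWord α) : p u := by
  obtain ⟨w, hw⟩ := u
  induction w using List.reverseRecOn with
  | nil => exact nil
  | append_singleton w x ih =>
    obtain ⟨t, a⟩ := x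
    obtain ⟨n, hn⟩ := hw (t, a) (by simp)
    obtain rfl : t = (n : ℝ≥0) / 2 := hn
    exact snoc ⟨w, fun x hx => hw x (by simp [hx])⟩ n a (ih _)

theorem IsResetFunction.half {R : TimedWord α → ℝ≥0} (hR : IsResetFunction R) (u : HIWord α) :
    ∃ m : ℕ, R u.1 = (m : ℝ≥0) / 2 := by
  induction u using HIWord.induction with
  | nil => exact ⟨0, by simpa [HIWord.nil] using hR.1⟩
  | snoc u n a ih =>
    obtain ⟨m, hm⟩ := ih
    rcases hR.2 u.1 ((n : ℝ≥0) / 2) a with h | h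
    · exact ⟨0, by simpa [HIWord.snoc] using h⟩
    · exact ⟨m + n, by rw [HIWord.snoc, h, hm]; push_cast; rw [add_div]⟩

/-- The clock of a machine is itself a reset function of the word read. -/
theorem ClockMachine.half {S : Type*} (M : ClockMachine α S) (s : S) (u : HIWord α) :
    ∃ m : ℕ, (M.run (s, 0) u.1).2 = (m : ℝ≥0) / 2 := by
  refine IsResetFunction.half (R := fun w => (M.run (s, 0) w).2) ⟨rfl, fun u t a => ?_⟩ u
  simp only [run_snoc, next]
  split_ifs
  · exact Or.inl rfl
  · exact Or.inr rfl

theorem isHalfIntegral_normalForm (R : TimedWord α → ℝ≥0) (w : TimedWord α) :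
    IsHalfIntegral (normalForm R w) := by
  induction w using List.reverseRecOn with
  | nil => intro p hp; simp [normalForm_nil] at hp
  | append_singleton w x ih =>
    intro p hp
    rw [normalForm_snoc, List.mem_append, List.mem_singleton] at hp
    rcases hp with hp | rfl
    · exact ih p hp
    · exact (normalForm_delay_spec _ _).1

/-- The normal form as a half-integral word. -/
noncomputable def normalWord (R : TimedWord α → ℝ≥0) (w : TimedWord α) : HIWord α :=
  ⟨normalForm R w, isHalfIntegral_normalForm R w⟩

/-- Both sides are half-integers in one region. Hence the delays of the normal form really start
from the value of `R` on it. -/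
theorem IsResetFunction.apply_normalForm {R : TimedWord α → ℝ≥0} (hR : IsResetFunction R)
    {w : TimedWord α} (h : RegionEq (R w) (R (normalForm R w))) :
    R (normalForm R w) = hi (R w) := by
  obtain ⟨m, hm⟩ := hR.half (normalWord R w)
  obtain ⟨n, hn⟩ := hi_eq_half (R w)
  exact (h.symm.trans (regionEq_hi _)).eq_of_half hm hn

end HalfIntegral

/-! ### The syntactic reset function of a recognizable language -/

section SyntacticReset

variable {α : Type*} {L : Set (TimedWord α)}

theorem residual_append (u v : TimedWord α) (L : Set (TimedWord α)) :
    residual (u ++ v) L = residual v (residual u L) := by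
  ext w
  simp [residual]

theorem syntacticReset_eq_zero {u : TimedWord α} (h : Recognizable (residual u L)) :
    syntacticReset L u = 0 := by
  induction u using List.reverseRecOn with
  | nil => rfl
  | append_singleton u p _ =>
    obtain ⟨t, a⟩ := p
    rw [syntacticReset_snoc, if_pos h]

theorem syntacticReset_snoc_of_not {u : TimedWord α} {t : ℝ≥0} {a : α}
    (h : ¬ Recognizable (residual (u ++ [(t, a)]) L)) :
    syntacticReset L (u ++ [(t, a)]) = syntacticReset L u + t := by
  rw [syntacticReset_snoc, if_neg h]

/-- The residuals of `u` and `v` are accepted from one state of a clock machine, at region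
equivalent clock values that are those of the syntactic reset function. -/
def SimilarReset (L : Set (TimedWord α)) (u v : TimedWord α) : Prop :=
  ∃ (S : Type) (_ : Finite S) (M : ClockMachine α S) (s : S),
    residual u L = M.lang (s, syntacticReset L u) ∧
    residual v L = M.lang (s, syntacticReset L v) ∧
    RegionEq (syntacticReset L u) (syntacticReset L v)

theorem Recognizable.similarReset_nil (h : Recognizable L) : SimilarReset L [] [] := by
  obtain ⟨S, hS, M, s, hL⟩ := h.exists_machine
  exact ⟨S, hS, M, s, hL, hL, RegionEq.refl _⟩

theorem SimilarReset.mem_iff {u v : TimedWord α} (h : SimilarReset L u v) : u ∈ L ↔ v ∈ L := by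
  obtain ⟨S, _, M, s, h1, h2, _⟩ := h
  have key : ∀ w : TimedWord α, w ∈ L ↔ [] ∈ residual w L := fun w => by simp [residual]
  rw [key u, key v, h1, h2]
  rfl

variable [Finite α]

/-- The machine witnessing similarity may change along the word: it is replaced whenever the
residual becomes recognizable, exactly when `R^L` resets. -/
theorem SimilarReset.snoc {u v : TimedWord α} (h : SimilarReset L u v) {t t' : ℝ≥0} (a : α)
    (ht : RegionEq (syntacticReset L u + t) (syntacticReset L v + t')) :
    SimilarReset L (u ++ [(t, a)]) (v ++ [(t', a)]) := by
  obtain ⟨S, hS, M, s, h1, h2, h3⟩ := h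
  obtain ⟨r, b, e1, e2⟩ := M.next_eq_of_regionEq s a ht
  have g1 : residual (u ++ [(t, a)]) L =
      M.lang (r, if b = true then 0 else syntacticReset L u + t) := by
    rw [residual_append, h1, M.residual_lang, ← e1]; rfl
  have g2 : residual (v ++ [(t', a)]) L =
      M.lang (r, if b = true then 0 else syntacticReset L v + t') := by
    rw [residual_append, h2, M.residual_lang, ← e2]; rfl
  have hreg : RegionEq (if b = true then 0 else syntacticReset L u + t)
      (if b = true then 0 else syntacticReset L v + t') := by
    split_ifs
    · exact RegionEq.refl _
    · exact ht
  by_cases hrec : Recognizable (residual (u ++ [(t, a)]) L)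
  -- A recognizable residual is constant on the region of the clock, so `u` and `v` now share it.
  · have heq : residual (v ++ [(t', a)]) L = residual (u ++ [(t, a)]) L := by
      rw [g1] at hrec
      rw [g1, g2, M.lang_eq_of_recognizable hrec hreg]
    obtain ⟨S', hS', M', s', h'⟩ := hrec.exists_machine
    refine ⟨S', hS', M', s', ?_, ?_, ?_⟩
    · rw [syntacticReset_eq_zero hrec, h']
    · rw [syntacticReset_eq_zero (heq ▸ hrec), heq, h']
    · rw [syntacticReset_eq_zero hrec, syntacticReset_eq_zero (heq ▸ hrec)]
      exact RegionEq.refl _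
  · have hrec' : ¬ Recognizable (residual (v ++ [(t', a)]) L) := by
      intro hr
      refine hrec ?_
      rw [g2] at hr
      rw [g1, M.lang_eq_of_recognizable hr hreg.symm]
      exact hr
    -- A reset would leave the language of `(r, 0)`, which is recognizable.
    have hb : b = false := by
      by_contra hb
      rw [Bool.not_eq_false] at hb
      subst hb
      exact hrec (g1 ▸ M.recognizable_lang_zero r)
    subst hb
    refine ⟨S, hS, M, r, ?_, ?_, ?_⟩
    · rw [syntacticReset_snoc_of_not hrec]; exact g1
    · rw [syntacticReset_snoc_of_not hrec']; exact g2
    · rw [syntacticReset_snoc_of_not hrec, syntacticReset_snoc_of_not hrec']; exact ht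

theorem Recognizable.similarReset_self (h : Recognizable L) (u : TimedWord α) :
    SimilarReset L u u := by
  induction u using List.reverseRecOn with
  | nil => exact h.similarReset_nil
  | append_singleton u p ih => exact ih.snoc _ (RegionEq.refl _)

theorem Recognizable.similarReset_normalForm (h : Recognizable L) (u : TimedWord α) :
    SimilarReset L u (normalForm (syntacticReset L) u) := by
  induction u using List.reverseRecOn with
  | nil => exact h.similarReset_nil
  | append_singleton u p ih =>
    obtain ⟨t, a⟩ := p
    rw [normalForm_snoc]
    refine ih.snoc a ?_
    obtain ⟨_, _, _, _, _, _, h3⟩ := ih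
    rw [(isResetFunction_syntacticReset L).apply_normalForm h3]
    exact (normalForm_delay_spec _ _).2

theorem Recognizable.residual_of_reset_eq_natCast (h : Recognizable L) {u : TimedWord α} {n : ℕ}
    (hn : syntacticReset L u = n) : Recognizable (residual u L) := by
  obtain ⟨S, _, M, s, h1, _, _⟩ := h.similarReset_self u
  rw [h1, hn]
  exact M.recognizable_lang_natCast s n

/-- Without a reset, the residual would sit at an integral clock value and be recognizable. This
yields strictness. -/
theorem Recognizable.reset_eq_zero_of_integral (h : Recognizable L) {u : TimedWord α} {t : ℝ≥0}
    (a : α) {n : ℕ} (hn : syntacticReset L u + t = n) :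
    syntacticReset L (u ++ [(t, a)]) = 0 := by
  by_contra h0
  have hnot : ¬ Recognizable (residual (u ++ [(t, a)]) L) := fun hr =>
    h0 (syntacticReset_eq_zero hr)
  exact hnot (h.residual_of_reset_eq_natCast ((syntacticReset_snoc_of_not hnot).trans hn))

end SyntacticReset

/-! ### The syntactic profile of the language of a clock machine -/

namespace Profile

variable {α : Type*} (P : Profile α)

theorem constant_le {K : ℕ} (h : P.C K) : P.constant ≤ K := sInf_le ⟨K, h, rfl⟩

theorem C_toNat_constant (h : P.constant < ⊤) : P.C P.constant.toNat := by
  have hne : ((fun K : ℕ => (K : ℕ∞)) '' {K | P.C K}).Nonempty := by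
    by_contra hne
    rw [Set.not_nonempty_iff_eq_empty] at hne
    rw [constant, hne, sInf_empty] at h
    exact lt_irrefl _ h
  obtain ⟨K, hK, he⟩ := csInf_mem hne
  have he : (K : ℕ∞) = P.constant := he
  rw [← he, ENat.toNat_natCast]
  exact hK

end Profile

section Machine

variable {α S : Type*} (M : ClockMachine α S) (s : S)

theorem residual_snoc_lang (u : TimedWord α) (t : ℝ≥0) (a : α) :
    residual (u ++ [(t, a)]) (M.lang (s, 0)) = M.lang (M.next (M.run (s, 0) u) (t, a)) := by
  rw [M.residual_lang, M.run_snoc]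

variable [Finite α] [Finite S]

/-- Whenever the machine resets, the residual is recognizable, so `R^L` resets as well. -/
theorem syntacticReset_le_run (u : TimedWord α) :
    syntacticReset (M.lang (s, 0)) u ≤ (M.run (s, 0) u).2 := by
  induction u using List.reverseRecOn with
  | nil => exact le_rfl
  | append_singleton u p ih =>
    obtain ⟨t, a⟩ := p
    by_cases hr : Recognizable (residual (u ++ [(t, a)]) (M.lang (s, 0)))
    · rw [syntacticReset_eq_zero hr]
      exact zero_le
    · rw [syntacticReset_snoc_of_not hr, M.run_snoc]
      rw [residual_snoc_lang] at hr
      simp only [ClockMachine.next] at hr ⊢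
      split_ifs at hr ⊢ with hb
      · exact absurd (M.recognizable_lang_zero _) hr
      · gcongr

/-- If `R^L(u) + n/2` exceeds the bound, so does the clock of the machine. Both delays then cause
the same move and leave the same residual, which is recognizable, so `R^L` is `0` after both. -/
theorem syntacticProfile_C : (syntacticProfile (M.lang (s, 0))).C M.bound := by
  intro u a n hn
  have h1 : (M.bound : ℝ≥0) < (M.run (s, 0) u.1).2 + (n : ℝ≥0) / 2 :=
    lt_of_lt_of_le hn (by gcongr; exact syntacticReset_le_run M s u.1)
  have h2 : (M.bound : ℝ≥0) < (M.run (s, 0) u.1).2 + ((2 * M.bound + 1 : ℕ) : ℝ≥0) / 2 := by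
    refine lt_of_lt_of_le ?_ le_add_self
    rw [lt_div_iff₀ (by norm_num)]
    exact_mod_cast (by omega : M.bound * 2 < 2 * M.bound + 1)
  have hst := M.step_congr (M.run (s, 0) u.1).1 a _ _ (regionEqK_iff.2 (Or.inr ⟨h1, h2⟩))
  have key : residual (u.snoc n a).1 (M.lang (s, 0)) =
      residual (u.snoc (2 * M.bound + 1) a).1 (M.lang (s, 0)) ∧
      Recognizable (residual (u.snoc n a).1 (M.lang (s, 0))) := by
    simp only [HIWord.snoc, residual_snoc_lang, ClockMachine.next, hst]
    split_ifs
    · exact ⟨rfl, M.recognizable_lang_zero _⟩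
    · exact ⟨M.lang_eq_of_bound_lt _ h1 h2, M.recognizable_lang_of_bound_lt _ h1⟩
  refine ⟨?_, key.1⟩
  rw [syntacticReset_eq_zero key.2, syntacticReset_eq_zero (key.1 ▸ key.2)]

theorem finite_quotient_syntacticProfile :
    Finite (Quotient (syntacticProfile (M.lang (s, 0))).rel) := by
  set L := M.lang (s, 0) with hL
  have hfin : (Set.range fun u : HIWord α =>
      (syntacticReset L u.1, residual u.1 L)).Finite := by
    -- `R^L(u)` is a half-integer at most the bound, since beyond it the residual is recognizable
    -- and `R^L(u) = 0`. Clock values above the bound are all represented by `bound + 1/2`.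
    refine (((Set.finite_Iic (2 * M.bound)).image fun m : ℕ => (m : ℝ≥0) / 2).prod
      (((Set.finite_univ (α := S)).prod (Set.finite_Iic (2 * M.bound + 1))).image
        fun p : S × ℕ => M.lang (p.1, (p.2 : ℝ≥0) / 2))).subset ?_
    rintro _ ⟨u, rfl⟩
    obtain ⟨m, hm⟩ := M.half s u
    have hres : residual u.1 L = M.lang ((M.run (s, 0) u.1).1, (m : ℝ≥0) / 2) := by
      rw [hL, M.residual_lang, ← hm]
    have hbig : ∀ j : ℕ, 2 * M.bound < j → (M.bound : ℝ≥0) < (j : ℝ≥0) / 2 := by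
      intro j hj
      rw [lt_div_iff₀ (by norm_num)]
      exact_mod_cast (by omega : M.bound * 2 < j)
    refine ⟨?_, ?_⟩
    · obtain ⟨i, hi⟩ := (isResetFunction_syntacticReset L).half u
      refine ⟨i, ?_, hi.symm⟩
      change i ≤ 2 * M.bound
      by_contra! hi'
      have h1 := (hbig i hi').trans_le (hi ▸ syntacticReset_le_run M s u.1)
      rw [hm] at h1
      have h0 := syntacticReset_eq_zero (hres ▸ M.recognizable_lang_of_bound_lt _ h1)
      have := hbig i hi'
      rw [← hi, h0] at this
      exact absurd this (by simp)
    · rcases le_or_gt m (2 * M.bound + 1) with h | h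
      · exact ⟨(_, m), ⟨trivial, h⟩, hres.symm⟩
      · refine ⟨((M.run (s, 0) u.1).1, 2 * M.bound + 1), ⟨trivial, Set.mem_Iic.2 le_rfl⟩, ?_⟩
        exact (M.lang_eq_of_bound_lt _ (hbig _ (by omega)) (hbig _ (by omega))).trans hres.symm
  have := hfin.to_subtype
  refine Finite.of_injective (β := Set.range fun u : HIWord α =>
      (syntacticReset L u.1, residual u.1 L)) (fun q => ⟨_, ⟨q.out, rfl⟩⟩) ?_
  intro q q' h
  obtain ⟨h1, h2⟩ := Prod.ext_iff.1 (Subtype.ext_iff.1 h)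
  rw [← q.out_eq, ← q'.out_eq]
  exact Quotient.sound ⟨h1, h2⟩

end Machine

section Syntactic

variable {α : Type*} (L : Set (TimedWord α))

theorem syntacticProfile_rel_snoc {u v : HIWord α} (h : (syntacticProfile L).rel u v) (n : ℕ)
    (a : α) : (syntacticProfile L).rel (u.snoc n a) (v.snoc n a) := by
  obtain ⟨h1, h2⟩ : syntacticReset L u.1 = syntacticReset L v.1 ∧
    residual u.1 L = residual v.1 L := h
  have h3 : residual (u.snoc n a).1 L = residual (v.snoc n a).1 L := by
    simp only [HIWord.snoc, residual_append, h2]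
  refine ⟨?_, h3⟩
  simp only [HIWord.snoc, syntacticReset_snoc] at h3 ⊢
  rw [h1, h3]

variable {L} [Finite α]

theorem Recognizable.preserving (h : Recognizable L) : (syntacticProfile L).Preserving L where
  mem_iff_of_rel u v huv := by
    have h2 := Set.ext_iff.1 (huv.2 : residual u.1 L = residual v.1 L) []
    simpa [residual] using h2
  mem_iff_normalForm w := (h.similarReset_normalForm w).mem_iff

theorem Recognizable.monotonic (h : Recognizable L) : (syntacticProfile L).Monotonic where
  regionEq u v huv := by
    have h1 : syntacticReset L u.1 = syntacticReset L v.1 := huv.1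
    refine Or.inl ?_
    change RegionEq (syntacticReset L u.1) (syntacticReset L v.1)
    rw [h1]
    exact RegionEq.refl _
  snoc u v huv n a := syntacticProfile_rel_snoc L huv n a
  regionEq_normalForm u := by
    obtain ⟨_, _, _, _, _, _, h3⟩ := h.similarReset_normalForm u
    exact h3

theorem Recognizable.finiteIndex (h : Recognizable L) : (syntacticProfile L).FiniteIndex := by
  obtain ⟨S, _, M, s, rfl⟩ := h.exists_machine
  exact ⟨finite_quotient_syntacticProfile M s,
    ((syntacticProfile _).constant_le (syntacticProfile_C M s)).trans_lt (ENat.natCast_lt_top _)⟩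

end Syntactic

/-! ### The canonical acceptor -/

section Canonical

variable {α : Type*} {L : Set (TimedWord α)}

/-- The class of a half-integral word. -/
noncomputable def canonicalClass (L : Set (TimedWord α)) (u : HIWord α) : CanonicalState L :=
  Quotient.mk (syntacticProfile L).rel u

theorem canonicalClass_eq_iff {u v : HIWord α} : canonicalClass L u = canonicalClass L v ↔
    syntacticReset L u.1 = syntacticReset L v.1 ∧ residual u.1 L = residual v.1 L :=
  Quotient.eq (r := (syntacticProfile L).rel)

theorem canonicalClass_snoc {u v : HIWord α} (h : canonicalClass L u = canonicalClass L v) (n : ℕ)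
    (a : α) : canonicalClass L (u.snoc n a) = canonicalClass L (v.snoc n a) :=
  canonicalClass_eq_iff.2 (syntacticProfile_rel_snoc L (canonicalClass_eq_iff.1 h) n a)

theorem exists_canonicalClass_eq (q : CanonicalState L) : ∃ u, canonicalClass L u = q :=
  Quotient.exists_rep q

/-- The representative of the source can be chosen freely, since `≈^L` is compatible with extension.
-/
theorem canonicalAcceptor_trans {θ : Transition α (CanonicalState L)}
    (hθ : θ ∈ (canonicalAcceptor L).trans) {u : HIWord α}
    (hu : θ.source = canonicalClass L u) : ∃ n : ℕ,
      θ.target = canonicalClass L (u.snoc n θ.letter) ∧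
      θ.guard = regionGuard (syntacticProfile L).constant.toNat
        (syntacticReset L u.1 + (n : ℝ≥0) / 2) ∧
      (θ.resets = true ↔ syntacticReset L (u.snoc n θ.letter).1 = 0) := by
  obtain ⟨u', v, n, h1, h2, h3, h4, h5⟩ := hθ
  have hu' : canonicalClass L u' = canonicalClass L u := h2.symm.trans hu
  have hv : canonicalClass L (u.snoc n θ.letter) = canonicalClass L v :=
    (canonicalClass_snoc hu' n θ.letter).symm.trans (canonicalClass_eq_iff.2 h1)
  refine ⟨n, h3.trans hv.symm, ?_, ?_⟩
  · rw [← (canonicalClass_eq_iff.1 hu').1]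
    exact h4
  · rw [(canonicalClass_eq_iff.1 hv).1]
    exact h5

/-- The clock of the acceptor is `R^L` on all timed words, while its state follows the normal form;
monotonicity keeps both in step. -/
theorem canonicalAcceptor_exists_isRun (hm : (syntacticProfile L).Monotonic)
    (w : TimedWord α) : ∃ e, (canonicalAcceptor L).IsRun ((canonicalAcceptor L).init, 0) w e
      (canonicalClass L (normalWord (syntacticReset L) w), syntacticReset L w) := by
  have hR : ∀ w, RegionEq (syntacticReset L w)
      (syntacticReset L (normalForm (syntacticReset L) w)) := hm.regionEq_normalForm
  have hhi := fun w => (isResetFunction_syntacticReset L).apply_normalForm (hR w)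
  refine TA.exists_isRun_of_forall_snoc (c := fun w =>
    (canonicalClass L (normalWord (syntacticReset L) w), syntacticReset L w)) rfl ?_ w
  intro w t a
  obtain ⟨⟨n, hn⟩, hreg⟩ := normalForm_delay_spec (syntacticReset L w) t
  have hsnoc : (normalWord (syntacticReset L) w).snoc n a =
      normalWord (syntacticReset L) (w ++ [(t, a)]) :=
    Subtype.ext (by simp only [normalWord, HIWord.snoc, normalForm_snoc, hn])
  refine ⟨⟨canonicalClass L (normalWord (syntacticReset L) w),
    canonicalClass L (normalWord (syntacticReset L) (w ++ [(t, a)])), a,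
    regionGuard (syntacticProfile L).constant.toNat
      (syntacticReset L (normalWord (syntacticReset L) w).1 + (n : ℝ≥0) / 2),
    decide (syntacticReset L (w ++ [(t, a)]) = 0)⟩, ⟨_, _, n, ?_, rfl, rfl, rfl, ?_⟩,
    rfl, rfl, ?_, ?_⟩
  · rw [hsnoc]
  -- The bit is read off `w` itself but must agree with the normal form: being `0` depends only on
  -- the region.
  · rw [decide_eq_true_iff]
    exact (hR _).eq_zero_iff
  · rw [mem_regionGuard]
    refine RegionEq.toK ?_
    rw [hn] at hreg
    rw [normalWord, hhi]
    exact hreg.symm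
  · refine Prod.ext rfl ?_
    simp only [decide_eq_true_iff]
    split_ifs with h
    · exact h
    · exact ((isResetFunction_syntacticReset L).2 w t a).resolve_left h

variable [Finite α]

theorem canonicalAcceptor_isDTA (hf : (syntacticProfile L).FiniteIndex) :
    (canonicalAcceptor L).IsDTA where
  finite_states := hf.finite_quotient
  finite_trans := by
    have := hf.finite_quotient
    refine (finite_transitions
      (finite_range_regionGuard (syntacticProfile L).constant.toNat)).subset ?_
    rintro θ ⟨u, v, n, _, _, _, h, _⟩
    exact ⟨_, h.symm⟩
  deterministic := by
    intro θ hθ θ' hθ' hne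
    by_contra! hcon
    obtain ⟨hs, hl, z, hz, hz'⟩ := hcon
    obtain ⟨u, hu⟩ := exists_canonicalClass_eq θ.source
    obtain ⟨n, h1, h2, h3⟩ := canonicalAcceptor_trans hθ hu.symm
    obtain ⟨n', h1', h2', h3'⟩ := canonicalAcceptor_trans hθ' (hs.symm.trans hu.symm)
    rw [h2, mem_regionGuard] at hz
    rw [h2', mem_regionGuard] at hz'
    have hreg := hz.trans hz'.symm
    rw [← hl] at h1' h3'
    -- Overlapping guards give one `K`-region: either a single half-integer lies in it, so `n = n'`,
    -- or both values exceed `K` and `C(K)` identifies the targets.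
    have hcls : canonicalClass L (u.snoc n θ.letter) = canonicalClass L (u.snoc n' θ.letter) := by
      rcases regionEqK_iff.1 hreg with h | h
      · obtain ⟨m, hm⟩ := (isResetFunction_syntacticReset L).half u
        have hsum : ∀ j : ℕ, syntacticReset L u.1 + (j : ℝ≥0) / 2 =
            ((m + j : ℕ) : ℝ≥0) / 2 := fun j => by rw [hm]; push_cast; rw [add_div]
        have h := add_left_cancel (h.eq_of_half (hsum n) (hsum n'))
        have : n = n' := by
          rw [div_left_inj' (by norm_num)] at h
          exact_mod_cast h
        rw [this]
      · have hC := (syntacticProfile L).C_toNat_constant hf.constant_lt_top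
        exact (canonicalClass_eq_iff.2 (hC u θ.letter n h.1)).trans
          (canonicalClass_eq_iff.2 (hC u θ.letter n' h.2)).symm
    have ht : θ.target = θ'.target := by rw [h1, h1', hcls]
    have hg : θ.guard = θ'.guard := by rw [h2, h2', regionGuard_congr hreg]
    have hr : θ.resets = θ'.resets := by
      rw [Bool.eq_iff_iff, h3, h3', (canonicalClass_eq_iff.1 hcls).1]
    obtain ⟨p, q, a, g, b⟩ := θ
    obtain ⟨p', q', a', g', b'⟩ := θ'
    simp only at hs hl ht hg hr
    exact hne (by rw [hs, hl, ht, hg, hr])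

theorem canonicalAcceptor_maxConst (hf : (syntacticProfile L).FiniteIndex) :
    (canonicalAcceptor L).maxConst = (syntacticProfile L).constant.toNat := by
  apply le_antisymm
  · refine csSup_le' ?_
    rintro _ ⟨θ, ⟨u, v, n, _, _, _, h, _⟩, rfl⟩
    change θ.guard.maxConst ≤ _
    rw [h]
    exact maxConst_regionGuard_le _ _
  -- Without letters `C(0)` holds vacuously. Otherwise the delay `K + 1/2` after the empty word has
  -- the guard `K < x`, in which `K` occurs.
  · rcases isEmpty_or_nonempty α with hα | ⟨⟨a⟩⟩
    · have : (syntacticProfile L).constant ≤ (0 : ℕ) :=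
        (syntacticProfile L).constant_le fun _ a => hα.elim a
      simp [nonpos_iff_eq_zero.1 this]
    · set K := (syntacticProfile L).constant.toNat with hK
      have hlt : (K : ℝ≥0) < syntacticReset L (HIWord.nil : HIWord α).1 +
          ((2 * K + 1 : ℕ) : ℝ≥0) / 2 := by
        refine lt_of_lt_of_le ?_ le_add_self
        rw [lt_div_iff₀ (by norm_num)]
        exact_mod_cast (by omega : K * 2 < 2 * K + 1)
      have hθ : (⟨canonicalClass L HIWord.nil, canonicalClass L (HIWord.nil.snoc (2 * K + 1) a), a,
          regionGuard K (syntacticReset L (HIWord.nil : HIWord α).1 +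
            ((2 * K + 1 : ℕ) : ℝ≥0) / 2),
          decide (syntacticReset L (HIWord.nil.snoc (2 * K + 1) a).1 = 0)⟩ :
          Transition α (CanonicalState L)) ∈ (canonicalAcceptor L).trans :=
        ⟨HIWord.nil, _, 2 * K + 1, Setoid.refl' _ _, rfl, rfl, rfl, decide_eq_true_iff⟩
      have := TA.maxConst_le_of_mem (canonicalAcceptor_isDTA hf).finite_trans hθ
      simp only [regionGuard, if_neg hlt.not_ge] at this
      exact this

theorem canonicalAcceptor_language (hp : (syntacticProfile L).Preserving L)
    (hm : (syntacticProfile L).Monotonic) (hf : (syntacticProfile L).FiniteIndex) :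
    (canonicalAcceptor L).language = L := by
  ext w
  obtain ⟨e, he⟩ := canonicalAcceptor_exists_isRun hm w
  rw [TA.mem_language_iff (canonicalAcceptor_isDTA hf).deterministic he, hp.mem_iff_normalForm w]
  constructor
  · rintro ⟨u, hu, h⟩
    exact (hp.mem_iff_of_rel _ _ (canonicalClass_eq_iff.1 h)).2 hu
  · exact fun h => ⟨normalWord (syntacticReset L) w, h, rfl⟩

theorem canonicalAcceptor_isAcceptor (hm : (syntacticProfile L).Monotonic)
    (hf : (syntacticProfile L).FiniteIndex) : (canonicalAcceptor L).IsAcceptor where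
  isDTA := canonicalAcceptor_isDTA hf
  complete w := by
    obtain ⟨e, he⟩ := canonicalAcceptor_exists_isRun hm w
    refine ⟨e, ⟨_, he⟩, ?_⟩
    rintro e' ⟨c, hc⟩
    exact (hc.unique (canonicalAcceptor_isDTA hf).deterministic he).1
  guard_region := by
    rintro θ ⟨u, v, n, _, _, _, h, _⟩
    rw [h, canonicalAcceptor_maxConst hf]
    exact ⟨_, denote_regionGuard _ _⟩
  state_region := by
    rw [canonicalAcceptor_maxConst hf]
    refine ⟨fun q => {z | RegionEqK ((syntacticProfile L).constant.toNat : ℕ∞)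
      (syntacticReset L (Quotient.out q).1) z}, fun q => ⟨_, rfl⟩, ?_⟩
    intro w e q y h
    obtain ⟨e', he'⟩ := canonicalAcceptor_exists_isRun hm w
    obtain ⟨hq, hy⟩ := Prod.ext_iff.1 (h.unique (canonicalAcceptor_isDTA hf).deterministic he').2
    have h1 : canonicalClass L (Quotient.out q) =
        canonicalClass L (normalWord (syntacticReset L) w) := (Quotient.out_eq q).trans hq
    have hy : y = syntacticReset L w := hy
    have hR : RegionEq (syntacticReset L w) (syntacticReset L (normalForm (syntacticReset L) w)) :=
      hm.regionEq_normalForm w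
    change RegionEqK _ _ y
    rw [(canonicalClass_eq_iff.1 h1).1, hy]
    exact hR.symm.toK

theorem Recognizable.canonicalAcceptor_isStrictAcceptor (h : Recognizable L) :
    (canonicalAcceptor L).IsStrictAcceptor where
  toIsAcceptor := canonicalAcceptor_isAcceptor h.monotonic h.finiteIndex
  strict := by
    intro θ hθ n hn
    obtain ⟨u, hu⟩ := exists_canonicalClass_eq θ.source
    obtain ⟨k, -, h2, h3⟩ := canonicalAcceptor_trans hθ hu.symm
    have hmem : syntacticReset L u.1 + (k : ℝ≥0) / 2 ∈ θ.guard.denote := by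
      rw [h2, mem_regionGuard]
      exact (RegionEq.refl _).toK
    rw [hn, Set.mem_singleton_iff] at hmem
    exact h3.2 (h.reset_eq_zero_of_integral θ.letter hmem)

end Canonical

/-- The states of `A` may lie in any universe, whereas `Recognizable` asks for `Type`; the machine
is turned back into an automaton with states in some `Fin n`. -/
theorem TA.recognizable_language {α Q : Type*} [Finite α] {A : TA α Q} (hA : A.IsDTA) :
    Recognizable A.language := by
  have := hA.finite_states
  rw [← TA.lang_machine hA]
  exact ClockMachine.recognizable_lang_zero _ _

/-! ### Minimality -/

section Minimal

variable {α Q : Type*} {B : TA α Q}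

theorem TA.Complete.exists_machine_run (hA : B.IsDTA) (hc : B.Complete) (w : TimedWord α) :
    ∃ e q y, B.IsRun (B.init, 0) w e (q, y) ∧
      (B.machine hA.finite_trans).run (some B.init, 0) w = (some q, y) := by
  obtain ⟨e, ⟨⟨q, y⟩, h⟩, -⟩ := hc w
  exact ⟨e, q, y, h, h.machine_run hA⟩

theorem TA.exists_trans_of_machine_next (hA : B.IsDTA) {q q' : Q} {y y' t : ℝ≥0} {a : α}
    (h : (B.machine hA.finite_trans).next (some q, y) (t, a) = (some q', y')) :
    ∃ θ ∈ B.trans, y + t ∈ θ.guard.denote ∧ y' = if θ.resets = true then 0 else y + t := by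
  by_cases hne : (B.enabled (some q) a (y + t)).Nonempty
  · obtain ⟨θ, hθ, hs, rfl, hg⟩ := hne
    cases hs
    rw [TA.machine_next hA hθ hg] at h
    exact ⟨θ, hθ, hg, (Prod.ext_iff.1 h).2.symm⟩
  · simp only [ClockMachine.next, TA.machine, TA.pick, dif_neg hne] at h
    exact absurd (Prod.ext_iff.1 h).1 (by simp)

/-- A `K`-region that contains an integer `n ≤ K` is `{n}`, so the guard is an equality. -/
theorem TA.IsStrictAcceptor.resets_of_natCast (hB : B.IsStrictAcceptor) {θ : Transition α Q}
    (hθ : θ ∈ B.trans) {n : ℕ} (hn : (n : ℝ≥0) ∈ θ.guard.denote) (hle : n ≤ B.maxConst) :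
    θ.resets = true := by
  refine hB.strict θ hθ n ?_
  obtain ⟨y, hy⟩ := hB.guard_region θ hθ
  rw [hy] at hn ⊢
  have hle' : (n : ℝ≥0) ≤ (B.maxConst : ℝ≥0) := by exact_mod_cast hle
  have hyn : y = n := by
    rcases regionEqK_iff.1 hn with h | h
    · exact h.eq_natCast
    · exact absurd h.2 hle'.not_gt
  subst hyn
  ext z
  constructor
  · intro hz
    rcases regionEqK_iff.1 hz with h | h
    · exact h.symm.eq_natCast
    · exact absurd h.1 hle'.not_gt
  · rintro rfl
    exact (RegionEq.refl _).toK

variable [Finite α]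

/-- The clock of a strict acceptor agrees with the syntactic reset function, or is beyond the
maximum constant, or is shifted by half an odd number. -/
theorem TA.IsStrictAcceptor.clock_cases (hB : B.IsStrictAcceptor) (u : HIWord α) {q : Q} {y : ℝ≥0}
    (h : (B.machine hB.isDTA.finite_trans).run (some B.init, 0) u.1 = (some q, y)) :
    y = syntacticReset B.language u.1 ∨ (B.maxConst : ℝ≥0) < y ∨
      ∃ k : ℕ, y = syntacticReset B.language u.1 + ((2 * k + 1 : ℕ) : ℝ≥0) / 2 := by
  have := hB.isDTA.finite_states
  induction u using HIWord.induction generalizing q y with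
  | nil => exact Or.inl (Prod.ext_iff.1 h).2.symm
  | snoc u n a ih =>
    obtain ⟨e, q₀, y₀, -, h₀⟩ := hB.complete.exists_machine_run hB.isDTA u.1
    have hnext := h
    rw [HIWord.snoc, ClockMachine.run_snoc, h₀] at hnext
    obtain ⟨θ, hθ, hg, hy⟩ := TA.exists_trans_of_machine_next hB.isDTA hnext
    have hle := syntacticReset_le_run (B.machine hB.isDTA.finite_trans) (some B.init) (u.snoc n a).1
    rw [TA.lang_machine hB.isDTA, h] at hle
    by_cases hr : θ.resets = true
    · rw [if_pos hr] at hy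
      subst hy
      -- `R^L` is at most the clock of `B`, which is `0` here.
      exact Or.inl (nonpos_iff_eq_zero.1 hle).symm
    · rw [if_neg hr] at hy
      rcases (isResetFunction_syntacticReset B.language).2 u.1 ((n : ℝ≥0) / 2) a with h0 | h0
      · obtain ⟨j, hj⟩ := (B.machine hB.isDTA.finite_trans).half (some B.init) (u.snoc n a)
        rw [h] at hj
        have hj : y = (j : ℝ≥0) / 2 := hj
        -- `R^L` resets and `B` does not. An integral clock up to the maximum constant would force
        -- `B` to reset; a clock that is not integral is an odd shift of `R^L = 0`.
        rcases Nat.even_or_odd' j with ⟨m, rfl | rfl⟩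
        · have hym : y = m := by rw [hj]; push_cast; field_simp
          refine Or.inr (Or.inl ?_)
          by_contra hlt
          rw [hym] at hlt
          have hmK : m ≤ B.maxConst := by exact_mod_cast not_lt.1 hlt
          refine hr (hB.resets_of_natCast hθ (n := m) ?_ hmK)
          rw [← hym, hy]
          exact hg
        · refine Or.inr (Or.inr ⟨m, ?_⟩)
          rw [HIWord.snoc, h0, zero_add, hj]
      · rw [HIWord.snoc, h0, hy]
        rcases ih h₀ with h1 | h1 | ⟨k, h1⟩
        · exact Or.inl (by rw [h1])
        · exact Or.inr (Or.inl (h1.trans_le le_self_add))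
        · exact Or.inr (Or.inr ⟨k, by rw [h1, add_right_comm]⟩)

/-- With an odd shift, one of `y` and `R^L(u)` is an integer, and either way the residual would be
recognizable. -/
theorem TA.IsStrictAcceptor.clock_eq_reset (hB : B.IsStrictAcceptor) (u : HIWord α) {q : Q}
    {y : ℝ≥0} (h : (B.machine hB.isDTA.finite_trans).run (some B.init, 0) u.1 = (some q, y))
    (hu : ¬ Recognizable (residual u.1 B.language)) :
    y = syntacticReset B.language u.1 ∧ y ≤ B.maxConst := by
  have := hB.isDTA.finite_states
  have hres : residual u.1 B.language =
      (B.machine hB.isDTA.finite_trans).lang (some q, y) := by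
    rw [← TA.lang_machine hB.isDTA, ClockMachine.residual_lang, h]
  have hle : y ≤ B.maxConst := by
    by_contra hlt
    exact hu (hres ▸ ClockMachine.recognizable_lang_of_bound_lt _ _ (not_le.1 hlt))
  refine ⟨?_, hle⟩
  rcases hB.clock_cases u h with h1 | h1 | ⟨k, h1⟩
  · exact h1
  · exact absurd h1 hle.not_gt
  · exfalso
    obtain ⟨i, hi⟩ := (isResetFunction_syntacticReset B.language).half u
    rcases Nat.even_or_odd' i with ⟨m, rfl | rfl⟩
    · refine hu ((TA.recognizable_language hB.isDTA).residual_of_reset_eq_natCast (n := m) ?_)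
      rw [hi]; push_cast; field_simp
    · have hy : y = (m + k + 1 : ℕ) := by
        rw [h1, hi]; push_cast; field_simp; ring
      rw [hy] at hres
      exact hu (hres ▸ ClockMachine.recognizable_lang_natCast _ _ _)

/-- Half-integral clocks in the region of `q` are equal or both beyond the maximum constant; either
way the residuals agree. If these are not recognizable, `R^L` is the clock, which is not beyond the
constant. -/
theorem TA.IsStrictAcceptor.canonicalClass_eq (hB : B.IsStrictAcceptor) {u v : HIWord α} {q : Q}
    {e e' : List (Transition α Q)} {y z : ℝ≥0} (hu : B.IsRun (B.init, 0) u.1 e (q, y))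
    (hv : B.IsRun (B.init, 0) v.1 e' (q, z)) :
    canonicalClass B.language u = canonicalClass B.language v := by
  have := hB.isDTA.finite_states
  obtain ⟨region, hreg, hmem⟩ := hB.state_region
  obtain ⟨x, hx⟩ := hreg q
  have hy := hmem _ _ _ _ hu
  have hz := hmem _ _ _ _ hv
  rw [hx] at hy hz
  have hyz : RegionEqK (B.maxConst : ℕ∞) y z := RegionEqK.trans (RegionEqK.symm hy) hz
  have ru := hu.machine_run hB.isDTA
  have rv := hv.machine_run hB.isDTA
  have hyz : y = z ∨ ((B.maxConst : ℝ≥0) < y ∧ (B.maxConst : ℝ≥0) < z) := by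
    refine (regionEqK_iff.1 hyz).imp_left fun h => ?_
    obtain ⟨m, hm⟩ := (B.machine hB.isDTA.finite_trans).half (some B.init) u
    obtain ⟨n, hn⟩ := (B.machine hB.isDTA.finite_trans).half (some B.init) v
    rw [ru] at hm
    rw [rv] at hn
    exact h.eq_of_half hm hn
  have hres : residual u.1 B.language = residual v.1 B.language := by
    rw [← TA.lang_machine hB.isDTA, ClockMachine.residual_lang, ClockMachine.residual_lang, ru, rv]
    rcases hyz with rfl | h
    · rfl
    · exact ClockMachine.lang_eq_of_bound_lt _ _ h.1 h.2
  refine canonicalClass_eq_iff.2 ⟨?_, hres⟩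
  by_cases hr : Recognizable (residual u.1 B.language)
  · rw [syntacticReset_eq_zero hr, syntacticReset_eq_zero (hres ▸ hr)]
  · obtain ⟨h1, h2⟩ := hB.clock_eq_reset u ru hr
    obtain ⟨h3, -⟩ := hB.clock_eq_reset v rv (hres ▸ hr)
    rw [← h1, ← h3]
    exact hyz.resolve_right fun h => h.1.not_ge h2

theorem TA.IsStrictAcceptor.card_canonicalState_le (hB : B.IsStrictAcceptor) :
    Nat.card (CanonicalState B.language) ≤ Nat.card Q := by
  have := hB.isDTA.finite_states
  have hrun : ∀ c : CanonicalState B.language, ∃ q, ∃ e y,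
      B.IsRun (B.init, 0) (Quotient.out c).1 e (q, y) := by
    intro c
    obtain ⟨e, q, y, h, -⟩ := hB.complete.exists_machine_run hB.isDTA (Quotient.out c).1
    exact ⟨q, e, y, h⟩
  choose f hf using hrun
  refine Nat.card_le_card_of_injective f fun c d hcd => ?_
  obtain ⟨e, y, h⟩ := hf c
  obtain ⟨e', z, h'⟩ := hf d
  rw [← hcd] at h'
  rw [← Quotient.out_eq c, ← Quotient.out_eq d]
  exact hB.canonicalClass_eq h h'

/-- Strictness plays no role for the constant. -/
theorem TA.IsDTA.maxConst_canonicalAcceptor_le (hB : B.IsDTA) :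
    (canonicalAcceptor B.language).maxConst ≤ B.maxConst := by
  have := hB.finite_states
  rw [canonicalAcceptor_maxConst (TA.recognizable_language hB).finiteIndex]
  refine ENat.toNat_le_of_le_natCast ((syntacticProfile B.language).constant_le ?_)
  have := syntacticProfile_C (B.machine hB.finite_trans) (some B.init)
  rwa [TA.lang_machine hB] at this

end Minimal

end OneClock

/-! ### Characterization and minimality -/

theorem theorem3 {α : Type*} [Finite α] (L : Set (OneClock.TimedWord α)) :
    -- (a) the characterization
    (OneClock.Recognizable L ↔
      (OneClock.syntacticProfile L).Preserving L ∧ (OneClock.syntacticProfile L).Monotonic ∧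
        (OneClock.syntacticProfile L).FiniteIndex) ∧
    -- the canonical acceptor is a strict acceptor for `L`
    (OneClock.Recognizable L →
      (OneClock.canonicalAcceptor L).IsStrictAcceptor ∧
        (OneClock.canonicalAcceptor L).language = L) ∧
    -- (b) it is minimal among the strict acceptors for `L`, in states and in constant
    (∀ (Q : Type*) (B : OneClock.TA α Q), B.IsStrictAcceptor → B.language = L →
      Nat.card (OneClock.CanonicalState L) ≤ Nat.card Q ∧
        (OneClock.canonicalAcceptor L).maxConst ≤ B.maxConst) := by
  refine ⟨⟨fun h => ⟨h.preserving, h.monotonic, h.finiteIndex⟩, fun ⟨hp, hm, hf⟩ => ?_⟩,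
    fun h => ⟨h.canonicalAcceptor_isStrictAcceptor,
      OneClock.canonicalAcceptor_language h.preserving h.monotonic h.finiteIndex⟩, ?_⟩
  · rw [← OneClock.canonicalAcceptor_language hp hm hf]
    exact OneClock.TA.recognizable_language (OneClock.canonicalAcceptor_isDTA hf)
  · rintro Q B hB rfl
    exact ⟨hB.card_canonicalState_le, hB.isDTA.maxConst_canonicalAcceptor_le⟩
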